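/- For a monoid $M$, the family $\operatorname{Rat}(M)$ of rational subsets of $M$ is the smallest family of subsets of $M$ that contains all finite subsets and is closed under $L_1\cup L_2$, $L_1\cdot L_2$ and the Kleene star $L^*$ (the submonoid generated by $L$). For a submonoid $N\leq M$, a subset of $M$ is called flat rational over $N$ if it is a finite union of sets of the form $L_0g_1L_1\cdots g_tL_t$ with $t\geq 0$, $L_i\in\operatorname{Rat}(N)$ and $g_i\in M$. A finite Boolean combination of such sets is a set obtained from them by finitely many unions, intersections and complements in $M$; it is described by a Boolean expression whose atoms are flat rational expressions, in which the $L_i$ are given by rational expressions over $N$ (finite sets being given as lists of elements). Then the following holds for $M=\mathrm{GL}(2,\mathbb{Q})$ and $N=\mathrm{GL}(2,\mathbb{Z})$, where matrices are given by their entries and rational numbers by numerator and denominator. The finite Boolean combinations of flat rational subsets of $\mathrm{GL}(2,\mathbb{Q})$ over $\mathrm{GL}(2,\mathbb{Z})$ are exactly the sets described by such Boolean expressions, and there is an algorithm that, given such a Boolean expression, decides whether the set $B\subseteq\mathrm{GL}(2,\mathbb{Q})$ that it describes is empty. -/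

import Mathlib

namespace FlatRational

section Sets

open scoped Pointwise

/-- The family of rational subsets of a monoid `M`: the least family that contains the finite
subsets and is closed under union, product and Kleene star (the generated submonoid). -/
inductive IsRational {M : Type*} [Monoid M] : Set M → Prop
  | finite (L : Set M) : L.Finite → IsRational L
  | union (L₁ L₂ : Set M) : IsRational L₁ → IsRational L₂ → IsRational (L₁ ∪ L₂)
  | mul (L₁ L₂ : Set M) : IsRational L₁ → IsRational L₂ → IsRational (L₁ * L₂)
  | star (L : Set M) : IsRational L → IsRational (Submonoid.closure L : Set M)

/-- The sets `L₀ g₁ L₁ ⋯ gₜ Lₜ` with `t ≥ 0`, every `Lᵢ` a rational subset of the submonoid `N`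
and every `gᵢ` an element of `M`. -/
inductive IsFlatProduct {M : Type*} [Monoid M] (N : Submonoid M) : Set M → Prop
  | base (L : Set N) : IsRational L → IsFlatProduct N ((↑) '' L)
  | snoc (P : Set M) (g : M) (L : Set N) : IsFlatProduct N P → IsRational L →
      IsFlatProduct N (P * {g} * ((↑) '' L))

/-- `L` is a flat rational subset of `M` over `N`: a finite union of sets
`L₀ g₁ L₁ ⋯ gₜ Lₜ`. -/
def IsFlatRational {M : Type*} [Monoid M] (N : Submonoid M) (L : Set M) : Prop :=
  ∃ S : Set (Set M), S.Finite ∧ (∀ P ∈ S, IsFlatProduct N P) ∧ L = ⋃₀ S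

end Sets

section Expressions

open scoped Pointwise

/-- Rational expressions over a monoid `M`; the finite sets are given by lists. -/
inductive RatExpr (M : Type*)
  | finite (l : List M)
  | union (e₁ e₂ : RatExpr M)
  | mul (e₁ e₂ : RatExpr M)
  | star (e : RatExpr M)

/-- The rational set described by a rational expression. -/
def RatExpr.eval {M : Type*} [Monoid M] : RatExpr M → Set M
  | .finite l => {x | x ∈ l}
  | .union e₁ e₂ => e₁.eval ∪ e₂.eval
  | .mul e₁ e₂ => e₁.eval * e₂.eval
  | .star e => (Submonoid.closure e.eval : Set M)

/-- Formal products `e₀ g₁ e₁ ⋯ gₜ eₜ`. -/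
inductive FlatTerm {M : Type*} [Monoid M] (N : Submonoid M)
  | base (e : RatExpr N)
  | snoc (p : FlatTerm N) (g : M) (e : RatExpr N)

/-- The set described by a formal product. -/
def FlatTerm.eval {M : Type*} [Monoid M] {N : Submonoid M} : FlatTerm N → Set M
  | .base e => (↑) '' e.eval
  | .snoc p g e => p.eval * {g} * ((↑) '' e.eval)

/-- Boolean expressions over flat rational expressions. A flat rational expression is a finite
list of formal products, read as their union. Complements are taken in `M`. -/
inductive BoolExpr {M : Type*} [Monoid M] (N : Submonoid M)
  | flat (l : List (FlatTerm N))
  | union (b₁ b₂ : BoolExpr N)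
  | inter (b₁ b₂ : BoolExpr N)
  | compl (b : BoolExpr N)

/-- The subset of `M` described by a Boolean expression. -/
def BoolExpr.eval {M : Type*} [Monoid M] {N : Submonoid M} : BoolExpr N → Set M
  | .flat l => {x | ∃ t ∈ l, x ∈ t.eval}
  | .union b₁ b₂ => b₁.eval ∪ b₂.eval
  | .inter b₁ b₂ => b₁.eval ∩ b₂.eval
  | .compl b => b.evalᶜ

end Expressions

section Coding

/-- The code of a rational expression, given a coding `c` of the monoid elements. -/
def RatExpr.code {M : Type*} (c : M → ℕ) : RatExpr M → ℕ
  | .finite l => Nat.pair 0 (Encodable.encode (l.map c))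
  | .union e₁ e₂ => Nat.pair 1 (Nat.pair (e₁.code c) (e₂.code c))
  | .mul e₁ e₂ => Nat.pair 2 (Nat.pair (e₁.code c) (e₂.code c))
  | .star e => Nat.pair 3 (e.code c)

/-- The code of a formal product, given a coding `c` of the elements of `M`. -/
def FlatTerm.code {M : Type*} [Monoid M] {N : Submonoid M} (c : M → ℕ) : FlatTerm N → ℕ
  | .base e => Nat.pair 0 (e.code fun h : N => c h)
  | .snoc p g e => Nat.pair 1 (Nat.pair (p.code c) (Nat.pair (c g) (e.code fun h : N => c h)))

/-- The code of a Boolean expression, given a coding `c` of the elements of `M`. -/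
def BoolExpr.code {M : Type*} [Monoid M] {N : Submonoid M} (c : M → ℕ) : BoolExpr N → ℕ
  | .flat l => Nat.pair 0 (Encodable.encode (l.map (FlatTerm.code c)))
  | .union b₁ b₂ => Nat.pair 1 (Nat.pair (b₁.code c) (b₂.code c))
  | .inter b₁ b₂ => Nat.pair 2 (Nat.pair (b₁.code c) (b₂.code c))
  | .compl b => Nat.pair 3 (b.code c)

/-- A rational number is coded by its numerator and denominator in lowest terms. -/
def ratCode (q : ℚ) : ℕ := Nat.pair (Equiv.intEquivNat q.num) q.den

/-- An invertible rational matrix is coded by its four entries. -/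
def matCode (g : GL (Fin 2) ℚ) : ℕ :=
  Nat.pair (Nat.pair (ratCode (g.val 0 0)) (ratCode (g.val 0 1)))
    (Nat.pair (ratCode (g.val 1 0)) (ratCode (g.val 1 1)))

end Coding

/-- `GL(2,ℤ)` as a submonoid of `GL(2,ℚ)`: the image under the entrywise inclusion. -/
def GL2Z : Submonoid (GL (Fin 2) ℚ) :=
  (Matrix.GeneralLinearGroup.map (n := Fin 2) (Int.castRingHom ℚ)).range.toSubmonoid

end FlatRational

/-! The Sanov subgroup `F` of `GL(2,ℤ)`, generated by the two elementary matrices with off-diagonal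
entry 2, is free of rank two, and membership in it is a congruence condition together with
determinant one. The elements of a flat rational set and their inverses have bounded denominators,
since boundedly many fixed matrices are interleaved with elements of `GL(2,ℤ)`. Two matrices with
denominators bounded in this way whose entries are sufficiently congruent differ by a left factor
from `F`. Hence all atoms of an expression live in finitely many right cosets `F t`
(`HasBoundedDenominators.exists_representatives`), and determinants show that these never exhaust
`GL(2,ℚ)`.

Every atom has a finite automaton with labels in `GL(2,ℚ)`. States are paired with coset
representatives: an edge with label `g` leads from `(p, t)` to `(q, t')` and produces the element
`w` of `F` with `t g = w t'`. This is an automaton over a free group, so the method of Benois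
applies: once the relations that produce words of length at most one are closed under composition,
every product of labels is also produced along its reduced word (`IsSaturated.exists_relWord`). By
the subset construction, the atoms that contain `sanov f * t` can be read off from the set of
vertices reached by the reduced word of `f`. Only finitely many such sets occur, so any Boolean
condition, complements included, is settled by inspecting them; elements outside the cosets lie in
no atom and add one more case (`IsSaturated.exists_iff`).

The finite data are not computed but searched for. A certificate (vertices, depth of saturation,
quotients that separate cosets, depth of exploration) has a primitive recursive validity test, every
valid certificate gives the right answer, and one always exists (`exists_computable_satisfiable`).
The description of Boolean combinations by expressions is a structural induction. -/

namespace FlatRational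

/-! ### Primitive recursive predicates on lists, and the gcd. -/

section PrimrecTools

variable {α β σ : Type*} [Primcodable α] [Primcodable β] [Primcodable σ]

theorem primrecPred_exists_mem {f : α → List β} {p : α → β → Prop} (hf : Primrec f)
    (hp : PrimrecRel p) : PrimrecPred fun a => ∃ b ∈ f a, p a b :=
  (PrimrecRel.exists_mem_list hp.swap).comp hf Primrec.id

theorem primrecPred_forall_mem {f : α → List β} {p : α → β → Prop} (hf : Primrec f)
    (hp : PrimrecRel p) : PrimrecPred fun a => ∀ b ∈ f a, p a b :=
  (PrimrecRel.forall_mem_list hp.swap).comp hf Primrec.id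

theorem primrecPred_mem {f : α → List β} {g : α → β} (hf : Primrec f) (hg : Primrec g) :
    PrimrecPred fun a => g a ∈ f a :=
  (primrecPred_exists_mem (p := fun a b => b = g a) hf
    (Primrec.eq.comp Primrec.snd (hg.comp Primrec.fst))).of_eq fun a => by simp

theorem primrecPred_imp {p q : α → Prop} (hp : PrimrecPred p) (hq : PrimrecPred q) :
    PrimrecPred fun a => p a → q a :=
  (hp.not.or hq).of_eq fun a => by tauto

theorem primrec_list_filter {f : α → List β} {p : α → β → Prop} [∀ a, DecidablePred (p a)]
    (hf : Primrec f) (hp : PrimrecRel p) : Primrec fun a => (f a).filter fun b => p a b := by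
  classical
  refine ((PrimrecRel.listFilter hp.swap).comp hf Primrec.id).of_eq fun a => ?_
  exact List.filter_congr fun x _ => by simp [Function.swap]

theorem primrec_nat_gcd : Primrec₂ Nat.gcd := by
  classical
  -- Unless both arguments vanish, `a + b` bounds all common divisors; if both vanish, the bound 0
  -- yields the correct value 0.
  have h : Primrec₂ fun a b : ℕ => Nat.findGreatest (fun k => a % k = 0 ∧ b % k = 0) (a + b) := by
    refine Primrec.nat_findGreatest (f := fun x : ℕ × ℕ => x.1 + x.2)
      (p := fun x k => x.1 % k = 0 ∧ x.2 % k = 0) (Primrec.nat_add.comp Primrec.fst Primrec.snd) ?_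
    exact PrimrecPred.and
      (Primrec.eq.comp (Primrec.nat_mod.comp (Primrec.fst.comp Primrec.fst) Primrec.snd)
        (Primrec.const 0))
      (Primrec.eq.comp (Primrec.nat_mod.comp (Primrec.snd.comp Primrec.fst) Primrec.snd)
        (Primrec.const 0))
  refine h.of_eq fun a b => ?_
  simp only [← Nat.dvd_iff_mod_eq_zero]
  rcases Nat.eq_zero_or_pos (a + b) with h0 | h0
  · obtain ⟨rfl, rfl⟩ : a = 0 ∧ b = 0 := by omega
    simp
  · have hg : a.gcd b ≤ a + b := by
      rcases Nat.eq_zero_or_pos a with rfl | ha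
      · simp
      · exact (Nat.gcd_le_left b ha).trans (by omega)
    apply le_antisymm
    · have hpos : 0 < a.gcd b := Nat.gcd_pos_iff.2 (by omega)
      have := Nat.findGreatest_spec (P := fun k => k ∣ a ∧ k ∣ b) hg
        ⟨Nat.gcd_dvd_left a b, Nat.gcd_dvd_right a b⟩
      exact Nat.le_of_dvd hpos (Nat.dvd_gcd this.1 this.2)
    · exact Nat.le_findGreatest hg ⟨Nat.gcd_dvd_left a b, Nat.gcd_dvd_right a b⟩

end PrimrecTools

/-! ### Recursion over numerical codes of trees. -/

section TreeRecursion

theorem unpair_snd_lt {n : ℕ} (h : n.unpair.1 ≠ 0) : n.unpair.2 < n := by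
  conv_rhs => rw [← Nat.pair_unpair n]
  generalize n.unpair.1 = a at *
  generalize n.unpair.2 = b
  unfold Nat.pair
  split_ifs <;> nlinarith [Nat.pos_of_ne_zero h]

/-- Recursion over codes of trees: a code `pair 0 m` is a leaf with content `m`, while a code
`pair (t + 1) m` is a node with label `t + 1` whose children are read off from `m`. -/
def treeRec {σ : Type*} (base : ℕ → σ) (step : ℕ → ℕ → σ → σ → σ → σ) (n : ℕ) : σ :=
  if h : n.unpair.1 = 0 then base n.unpair.2
  else
    have := unpair_snd_lt h
    have := Nat.unpair_left_le n.unpair.2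
    have := Nat.unpair_right_le n.unpair.2
    step n.unpair.1 n.unpair.2 (treeRec base step n.unpair.2)
      (treeRec base step n.unpair.2.unpair.1) (treeRec base step n.unpair.2.unpair.2)
termination_by n

variable {σ : Type*} (base : ℕ → σ) (step : ℕ → ℕ → σ → σ → σ → σ)

theorem treeRec_leaf (m : ℕ) : treeRec base step (Nat.pair 0 m) = base m := by
  rw [treeRec]; simp

theorem treeRec_node (t m : ℕ) : treeRec base step (Nat.pair (t + 1) m) =
    step (t + 1) m (treeRec base step m) (treeRec base step m.unpair.1)
      (treeRec base step m.unpair.2) := by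
  rw [treeRec]; simp

/-- Induction along `treeRec`. -/
theorem treeRec_induction {P : ℕ → σ → Prop} (hb : ∀ m, P (Nat.pair 0 m) (base m))
    (hs : ∀ t m x y z, P m x → P m.unpair.1 y → P m.unpair.2 z →
      P (Nat.pair (t + 1) m) (step (t + 1) m x y z)) (n : ℕ) : P n (treeRec base step n) := by
  induction n using Nat.strong_induction_on with
  | _ n ih =>
    rw [← Nat.pair_unpair n]
    rcases h : n.unpair.1 with _ | t
    · rw [treeRec_leaf]; exact hb _
    · have hlt : n.unpair.2 < n := unpair_snd_lt (by omega)
      rw [treeRec_node]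
      exact hs _ _ _ _ _ (ih _ hlt) (ih _ ((Nat.unpair_left_le _).trans_lt hlt))
        (ih _ ((Nat.unpair_right_le _).trans_lt hlt))

/-- Children of a node have smaller codes, so this is course-of-values recursion over the list of
earlier values. -/
theorem primrec_treeRec {α σ : Type*} [Primcodable α] [Primcodable σ] [Inhabited σ]
    {base : α → ℕ → σ} {step : α → ℕ → ℕ → σ → σ → σ → σ} (hb : Primrec₂ base)
    (hs : Primrec fun x : α × (ℕ × ℕ) × σ × σ × σ =>
      step x.1 x.2.1.1 x.2.1.2 x.2.2.1 x.2.2.2.1 x.2.2.2.2) :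
    Primrec₂ fun a n => treeRec (base a) (step a) n := by
  classical
  -- The length of the list of earlier values is the current code; all lookups lie below it, so
  -- `default` is never returned.
  let g : α → List σ → Option σ := fun a L =>
    if L.length.unpair.1 = 0 then some (base a L.length.unpair.2)
    else some (step a L.length.unpair.1 L.length.unpair.2
      (L.getD L.length.unpair.2 default) (L.getD L.length.unpair.2.unpair.1 default)
      (L.getD L.length.unpair.2.unpair.2 default))
  have hlen : Primrec fun x : α × List σ => x.2.length.unpair :=
    Primrec.unpair.comp (Primrec.list_length.comp Primrec.snd)
  have hl := Primrec.fst.comp hlen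
  have hr := Primrec.snd.comp hlen
  have hget {k : α × List σ → ℕ} (hk : Primrec k) :
      Primrec fun x : α × List σ => x.2.getD (k x) default :=
    (Primrec.list_getD default).comp Primrec.snd hk
  refine Primrec.nat_strong_rec _ (g := g) ?_ ?_
  · refine Primrec.ite (Primrec.eq.comp hl (Primrec.const 0))
      (Primrec.option_some.comp (hb.comp Primrec.fst hr)) (Primrec.option_some.comp ?_)
    exact hs.comp (Primrec.fst.pair ((hl.pair hr).pair ((hget hr).pair
      ((hget (Primrec.fst.comp (Primrec.unpair.comp hr))).pair
        (hget (Primrec.snd.comp (Primrec.unpair.comp hr)))))))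
  · intro a n
    have hget' : ∀ k < n, (((List.range n).map fun n => treeRec (base a) (step a) n).getD k default)
        = treeRec (base a) (step a) k := by
      intro k hk
      simp [List.getD_eq_getElem?_getD, hk]
    simp only [g, List.length_map, List.length_range]
    split_ifs with h
    · conv_rhs => rw [treeRec]
      simp [h]
    · have hlt := unpair_snd_lt h
      rw [hget' _ hlt, hget' _ ((Nat.unpair_left_le _).trans_lt hlt),
        hget' _ ((Nat.unpair_right_le _).trans_lt hlt)]
      conv_rhs => rw [treeRec]
      simp [h]

end TreeRecursion

/-! ### Primitive recursive arithmetic of rational numbers. -/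

section RationalCoding

/-- The coding structure induced by an injective code with primitive recursive range. -/
noncomputable abbrev primcodableOfCode {X : Type*} (c : X → ℕ) (hc : Function.Injective c)
    (h : PrimrecPred (· ∈ Set.range c)) : Primcodable X :=
  letI := Classical.decPred (· ∈ Set.range c)
  letI := Primcodable.subtype h
  Primcodable.ofEquiv (Set.range c) (Equiv.ofInjective c hc)

theorem intEquivNat_natCast (k : ℕ) : Equiv.intEquivNat (k : ℤ) = 2 * k := rfl

theorem intEquivNat_negSucc (k : ℕ) : Equiv.intEquivNat (Int.negSucc k) = 2 * k + 1 := rfl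

theorem intEquivNat_neg {k : ℕ} (hk : 0 < k) : Equiv.intEquivNat (-(k : ℤ)) = 2 * k - 1 := by
  obtain ⟨k, rfl⟩ : ∃ j, k = j + 1 := ⟨k - 1, by omega⟩
  rw [show -((k + 1 : ℕ) : ℤ) = Int.negSucc k from rfl, intEquivNat_negSucc]
  omega

theorem ratCode_injective : Function.Injective ratCode := by
  intro p q h
  simp only [ratCode, Nat.pair_eq_pair, EmbeddingLike.apply_eq_iff_eq] at h
  exact Rat.ext h.1 h.2

/-- On codes of integers, `m ↦ (m + 1) / 2` is the absolute value, so the condition expresses lowest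
terms. -/
theorem mem_range_ratCode (n : ℕ) : n ∈ Set.range ratCode ↔
    n.unpair.2 ≠ 0 ∧ ((n.unpair.1 + 1) / 2).gcd n.unpair.2 = 1 := by
  have habs : ∀ z : ℤ, (Equiv.intEquivNat z + 1) / 2 = z.natAbs := by
    rintro (k | k)
    · rw [Int.ofNat_eq_natCast, intEquivNat_natCast]; simp; omega
    · rw [intEquivNat_negSucc]; simp; omega
  constructor
  · rintro ⟨q, rfl⟩
    simpa [ratCode, habs] using q.reduced
  · rintro ⟨h0, h1⟩
    obtain ⟨z, hz⟩ := Equiv.intEquivNat.surjective n.unpair.1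
    refine ⟨⟨z, n.unpair.2, h0, ?_⟩, ?_⟩
    · rw [← hz, habs] at h1; exact h1
    · simp [ratCode, hz]

theorem primrecPred_mem_range_ratCode : PrimrecPred (· ∈ Set.range ratCode) := by
  refine PrimrecPred.of_eq ?_ fun n => (mem_range_ratCode n).symm
  have h2 : Primrec fun n : ℕ => n.unpair.2 := Primrec.snd.comp Primrec.unpair
  refine PrimrecPred.and (Primrec.eq.comp h2 (Primrec.const 0)).not
    (Primrec.eq.comp (primrec_nat_gcd.comp ?_ h2) (Primrec.const 1))
  exact Primrec.nat_div.comp (Primrec.succ.comp (Primrec.fst.comp Primrec.unpair))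
    (Primrec.const 2)

/-- Rational numbers coded by `ratCode`. -/
noncomputable instance ratPrimcodable : Primcodable ℚ :=
  primcodableOfCode ratCode ratCode_injective primrecPred_mem_range_ratCode

theorem primrec_ratCode : Primrec ratCode := Primrec.encode (α := ℚ)

theorem primrec_iff_ratCode {α : Type*} [Primcodable α] {f : α → ℚ} :
    Primrec f ↔ Primrec fun a => ratCode (f a) := (Primrec.encode_iff (f := f)).symm

theorem primrec_den : Primrec Rat.den :=
  (Primrec.snd.comp (Primrec.unpair.comp primrec_ratCode)).of_eq fun q => by simp [ratCode]

theorem primrec_num_toNat : Primrec fun q : ℚ => q.num.toNat := by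
  have h1 : Primrec fun q : ℚ => (ratCode q).unpair.1 :=
    Primrec.fst.comp (Primrec.unpair.comp primrec_ratCode)
  refine (Primrec.ite (c := fun q : ℚ => (ratCode q).unpair.1 % 2 = 0)
    (Primrec.eq.comp (Primrec.nat_mod.comp h1 (Primrec.const 2)) (Primrec.const 0))
    (Primrec.nat_div.comp h1 (Primrec.const 2)) (Primrec.const 0)).of_eq fun q => ?_
  rw [ratCode, Nat.unpair_pair]
  rcases q.num with k | k
  · rw [Int.ofNat_eq_natCast, intEquivNat_natCast]; simp
  · rw [intEquivNat_negSucc, if_neg (by omega)]; simp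

theorem primrec_neg_num_toNat : Primrec fun q : ℚ => (-q.num).toNat := by
  have h1 : Primrec fun q : ℚ => (ratCode q).unpair.1 :=
    Primrec.fst.comp (Primrec.unpair.comp primrec_ratCode)
  refine (Primrec.ite (c := fun q : ℚ => (ratCode q).unpair.1 % 2 = 0)
    (Primrec.eq.comp (Primrec.nat_mod.comp h1 (Primrec.const 2)) (Primrec.const 0))
    (Primrec.const 0) (Primrec.nat_div.comp (Primrec.succ.comp h1) (Primrec.const 2))).of_eq
    fun q => ?_
  rw [ratCode, Nat.unpair_pair]
  rcases q.num with k | k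
  · rw [Int.ofNat_eq_natCast, intEquivNat_natCast]; simp
  · rw [intEquivNat_negSucc, if_neg (by omega)]; simp; omega

/-- Integers are written as differences of naturals, which turns reduction to lowest terms into
natural number arithmetic. With truncated subtraction, `(p - n) + (n - p)` is the absolute value of
the difference. -/
theorem ratCode_mkRat_sub (p n r : ℕ) : ratCode (mkRat ((p : ℤ) - n) r) =
    if r = 0 then Nat.pair 0 1 else
      Nat.pair (if n ≤ p then 2 * ((p - n) / r.gcd ((p - n) + (n - p)))
        else 2 * ((n - p) / r.gcd ((p - n) + (n - p))) - 1) (r / r.gcd ((p - n) + (n - p))) := by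
  unfold ratCode
  rw [Rat.num_mkRat, Rat.den_mkRat]
  by_cases hr : r = 0
  · simp [hr]; rfl
  have habs : ((p : ℤ) - n).natAbs = (p - n) + (n - p) := by omega
  rw [habs]
  simp only [hr, if_false]
  congr 1
  split_ifs with h
  · rw [show ((p : ℤ) - n) = ((p - n : ℕ) : ℤ) by omega, ← Int.natCast_div, intEquivNat_natCast]
  · have h0 : p - n = 0 := by omega
    rw [h0, Nat.zero_add]
    have hd : r.gcd (n - p) ∣ n - p := Nat.gcd_dvd_right _ _
    have hg : 0 < r.gcd (n - p) := Nat.gcd_pos_of_pos_left _ (by omega)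
    rw [show ((p : ℤ) - n) = -((n - p : ℕ) : ℤ) by omega,
      Int.neg_ediv_of_dvd (Int.natCast_dvd_natCast.2 hd), ← Int.natCast_div, intEquivNat_neg]
    exact Nat.div_pos (Nat.le_of_dvd (by omega) hd) hg

theorem primrec_mkRat_sub {α : Type*} [Primcodable α] {p n r : α → ℕ} (hp : Primrec p)
    (hn : Primrec n) (hr : Primrec r) :
    Primrec fun a => mkRat ((p a : ℤ) - n a) (r a) := by
  rw [primrec_iff_ratCode]
  refine Primrec.of_eq ?_ fun a => (ratCode_mkRat_sub (p a) (n a) (r a)).symm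
  have hpn := Primrec.nat_sub.comp hp hn
  have hnp := Primrec.nat_sub.comp hn hp
  have hg := primrec_nat_gcd.comp hr (Primrec.nat_add.comp hpn hnp)
  have h2 := Primrec.const (α := α) 2
  refine Primrec.ite (Primrec.eq.comp hr (Primrec.const 0)) (Primrec.const _)
    (Primrec₂.natPair.comp (Primrec.ite (Primrec.nat_le.comp hn hp)
      (Primrec.nat_mul.comp h2 (Primrec.nat_div.comp hpn hg))
      (Primrec.nat_sub.comp (Primrec.nat_mul.comp h2 (Primrec.nat_div.comp hnp hg))
        (Primrec.const 1))) (Primrec.nat_div.comp hr hg))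

/-- Splitting numerators into positive and negative parts makes sums and products instances of
`primrec_mkRat_sub`. -/
theorem rat_eq_parts (q : ℚ) : q = ((q.num.toNat : ℚ) - ((-q.num).toNat : ℚ)) / q.den := by
  have h : ((q.num.toNat : ℚ) - ((-q.num).toNat : ℚ)) = q.num := by
    exact_mod_cast Int.toNat_sub_toNat_neg q.num
  rw [h, Rat.num_div_den]

theorem primrec_rat_mul : Primrec₂ ((· * ·) : ℚ → ℚ → ℚ) := by
  have p1 : Primrec fun x : ℚ × ℚ => x.1.num.toNat := primrec_num_toNat.comp Primrec.fst
  have p2 : Primrec fun x : ℚ × ℚ => x.2.num.toNat := primrec_num_toNat.comp Primrec.snd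
  have n1 : Primrec fun x : ℚ × ℚ => (-x.1.num).toNat := primrec_neg_num_toNat.comp Primrec.fst
  have n2 : Primrec fun x : ℚ × ℚ => (-x.2.num).toNat := primrec_neg_num_toNat.comp Primrec.snd
  have d1 : Primrec fun x : ℚ × ℚ => x.1.den := primrec_den.comp Primrec.fst
  have d2 : Primrec fun x : ℚ × ℚ => x.2.den := primrec_den.comp Primrec.snd
  refine (primrec_mkRat_sub
    (Primrec.nat_add.comp (Primrec.nat_mul.comp p1 p2) (Primrec.nat_mul.comp n1 n2))
    (Primrec.nat_add.comp (Primrec.nat_mul.comp p1 n2) (Primrec.nat_mul.comp n1 p2))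
    (Primrec.nat_mul.comp d1 d2)).of_eq fun x => ?_
  rw [Rat.mkRat_eq_div]
  conv_rhs => rw [rat_eq_parts x.1, rat_eq_parts x.2]
  push_cast
  ring

theorem primrec_rat_add : Primrec₂ ((· + ·) : ℚ → ℚ → ℚ) := by
  have p1 : Primrec fun x : ℚ × ℚ => x.1.num.toNat := primrec_num_toNat.comp Primrec.fst
  have p2 : Primrec fun x : ℚ × ℚ => x.2.num.toNat := primrec_num_toNat.comp Primrec.snd
  have n1 : Primrec fun x : ℚ × ℚ => (-x.1.num).toNat := primrec_neg_num_toNat.comp Primrec.fst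
  have n2 : Primrec fun x : ℚ × ℚ => (-x.2.num).toNat := primrec_neg_num_toNat.comp Primrec.snd
  have d1 : Primrec fun x : ℚ × ℚ => x.1.den := primrec_den.comp Primrec.fst
  have d2 : Primrec fun x : ℚ × ℚ => x.2.den := primrec_den.comp Primrec.snd
  refine (primrec_mkRat_sub
    (Primrec.nat_add.comp (Primrec.nat_mul.comp p1 d2) (Primrec.nat_mul.comp p2 d1))
    (Primrec.nat_add.comp (Primrec.nat_mul.comp n1 d2) (Primrec.nat_mul.comp n2 d1))
    (Primrec.nat_mul.comp d1 d2)).of_eq fun x => ?_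
  rw [Rat.mkRat_eq_div]
  conv_rhs => rw [rat_eq_parts x.1, rat_eq_parts x.2]
  have h1 : (x.1.den : ℚ) ≠ 0 := by exact_mod_cast x.1.den_nz
  have h2 : (x.2.den : ℚ) ≠ 0 := by exact_mod_cast x.2.den_nz
  push_cast
  field_simp
  ring

end RationalCoding

/-! ### Primitive recursive matrix multiplication and membership tests. -/

section MatrixCoding

theorem primrecPred_det_ne_zero : PrimrecPred fun m : (ℚ × ℚ) × ℚ × ℚ =>
    m.1.1 * m.2.2 ≠ m.1.2 * m.2.1 :=
  (Primrec.eq.comp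
    (primrec_rat_mul.comp (Primrec.fst.comp Primrec.fst) (Primrec.snd.comp Primrec.snd))
    (primrec_rat_mul.comp (Primrec.snd.comp Primrec.fst) (Primrec.fst.comp Primrec.snd))).not

/-- An invertible matrix as the quadruple of its entries. -/
noncomputable def glEquiv :
    GL (Fin 2) ℚ ≃ {m : (ℚ × ℚ) × ℚ × ℚ // m.1.1 * m.2.2 ≠ m.1.2 * m.2.1} where
  toFun g := ⟨((g.val 0 0, g.val 0 1), (g.val 1 0, g.val 1 1)), by
    have h := (Matrix.isUnit_iff_isUnit_det _).1 g.isUnit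
    rw [Matrix.det_fin_two] at h
    exact fun h' => h.ne_zero (sub_eq_zero.2 h')⟩
  invFun m := Matrix.GeneralLinearGroup.mkOfDetNeZero
    !![m.1.1.1, m.1.1.2; m.1.2.1, m.1.2.2] (by
      rw [Matrix.det_fin_two_of]; exact sub_ne_zero.2 m.2)
  left_inv g := by
    ext i j
    fin_cases i <;> fin_cases j <;> rfl
  right_inv m := rfl

noncomputable instance glPrimcodable : Primcodable (GL (Fin 2) ℚ) :=
  letI := Primcodable.subtype primrecPred_det_ne_zero
  Primcodable.ofEquiv _ glEquiv

/-- The instances are set up so that decoding inverts the prescribed coding of matrices. -/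
theorem encode_eq_matCode (g : GL (Fin 2) ℚ) : Encodable.encode g = matCode g := rfl

theorem primrec_entries : Primrec fun g : GL (Fin 2) ℚ =>
    ((g.val 0 0, g.val 0 1), (g.val 1 0, g.val 1 1)) := by
  let := Primcodable.subtype primrecPred_det_ne_zero
  exact Primrec.subtype_val.comp (Primrec.of_equiv (e := glEquiv))

theorem primrec_of_entries {α : Type*} [Primcodable α] {f : α → GL (Fin 2) ℚ}
    (h : Primrec fun a => (((f a).val 0 0, (f a).val 0 1), ((f a).val 1 0, (f a).val 1 1))) :
    Primrec f := by
  let := Primcodable.subtype primrecPred_det_ne_zero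
  exact (Primrec.of_equiv_iff glEquiv).1 (Primrec.subtype_val_iff.1 h)

theorem primrec_gl_mul : Primrec₂ ((· * ·) : GL (Fin 2) ℚ → GL (Fin 2) ℚ → GL (Fin 2) ℚ) := by
  have h1 : Primrec fun x : GL (Fin 2) ℚ × GL (Fin 2) ℚ => _ := primrec_entries.comp Primrec.fst
  have h2 : Primrec fun x : GL (Fin 2) ℚ × GL (Fin 2) ℚ => _ := primrec_entries.comp Primrec.snd
  have dot {f g h k : GL (Fin 2) ℚ × GL (Fin 2) ℚ → ℚ} (hf : Primrec f) (hg : Primrec g)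
      (hh : Primrec h) (hk : Primrec k) : Primrec fun x => f x * g x + h x * k x :=
    primrec_rat_add.comp (primrec_rat_mul.comp hf hg) (primrec_rat_mul.comp hh hk)
  have a1 := Primrec.fst.comp (Primrec.fst.comp h1)
  have b1 := Primrec.snd.comp (Primrec.fst.comp h1)
  have c1 := Primrec.fst.comp (Primrec.snd.comp h1)
  have d1 := Primrec.snd.comp (Primrec.snd.comp h1)
  have a2 := Primrec.fst.comp (Primrec.fst.comp h2)
  have b2 := Primrec.snd.comp (Primrec.fst.comp h2)
  have c2 := Primrec.fst.comp (Primrec.snd.comp h2)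
  have d2 := Primrec.snd.comp (Primrec.snd.comp h2)
  refine primrec_of_entries (f := fun x : GL (Fin 2) ℚ × GL (Fin 2) ℚ => x.1 * x.2) ?_
  refine (((dot a1 a2 b1 c2).pair (dot a1 b2 b1 d2)).pair
    ((dot c1 a2 d1 c2).pair (dot c1 b2 d1 d2))).of_eq fun x => ?_
  simp [Matrix.mul_apply, Fin.sum_univ_two]

/-- The congruence conditions that cut out the Sanov subgroup. -/
def IsSanov (g : GL (Fin 2) ℚ) : Prop :=
  ∃ a b c d : ℤ, g.val 0 0 = 1 + 4 * a ∧ g.val 0 1 = 2 * b ∧ g.val 1 0 = 2 * c ∧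
    g.val 1 1 = 1 + 4 * d ∧ g.val 0 0 * g.val 1 1 = g.val 0 1 * g.val 1 0 + 1

theorem rat_exists_int_iff (q : ℚ) : (∃ z : ℤ, q = z) ↔ q.den = 1 := by
  constructor
  · rintro ⟨z, rfl⟩; rfl
  · intro h
    exact ⟨q.num, ((Rat.den_eq_one_iff q).1 h).symm⟩

theorem primrecPred_isSanov : PrimrecPred IsSanov := by
  have a1 := Primrec.fst.comp (Primrec.fst.comp primrec_entries)
  have b1 := Primrec.snd.comp (Primrec.fst.comp primrec_entries)
  have c1 := Primrec.fst.comp (Primrec.snd.comp primrec_entries)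
  have d1 := Primrec.snd.comp (Primrec.snd.comp primrec_entries)
  have aff {f : GL (Fin 2) ℚ → ℚ} (hf : Primrec f) (r s : ℚ) :
      PrimrecPred fun g => (f g * r + s).den = 1 :=
    Primrec.eq.comp (primrec_den.comp (primrec_rat_add.comp
      (primrec_rat_mul.comp hf (Primrec.const r)) (Primrec.const s))) (Primrec.const 1)
  refine ((aff a1 (1 / 4) (-1 / 4)).and ((aff b1 (1 / 2) 0).and ((aff c1 (1 / 2) 0).and
    ((aff d1 (1 / 4) (-1 / 4)).and (Primrec.eq.comp (primrec_rat_mul.comp a1 d1)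
      (primrec_rat_add.comp (primrec_rat_mul.comp b1 c1) (Primrec.const 1))))))).of_eq fun g => ?_
  simp only [← rat_exists_int_iff]
  constructor
  · rintro ⟨⟨a, ha⟩, ⟨b, hb⟩, ⟨c, hc⟩, ⟨d, hd⟩, h⟩
    exact ⟨a, b, c, d, by linarith, by linarith, by linarith, by linarith, h⟩
  · rintro ⟨a, b, c, d, ha, hb, hc, hd, h⟩
    exact ⟨⟨a, by linarith⟩, ⟨b, by linarith⟩, ⟨c, by linarith⟩, ⟨d, by linarith⟩, h⟩

theorem mem_GL2Z_iff (g : GL (Fin 2) ℚ) : g ∈ GL2Z ↔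
    (∃ a b c d : ℤ, g.val 0 0 = a ∧ g.val 0 1 = b ∧ g.val 1 0 = c ∧ g.val 1 1 = d) ∧
      (g.val 0 0 * g.val 1 1 = g.val 0 1 * g.val 1 0 + 1 ∨
        g.val 0 0 * g.val 1 1 + 1 = g.val 0 1 * g.val 1 0) := by
  constructor
  · rintro ⟨h, rfl⟩
    have hdet : IsUnit h.val.det := (Matrix.isUnit_iff_isUnit_det _).1 h.isUnit
    refine ⟨⟨h.val 0 0, h.val 0 1, h.val 1 0, h.val 1 1, rfl, rfl, rfl, rfl⟩, ?_⟩
    rw [Matrix.det_fin_two, Int.isUnit_iff] at hdet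
    rcases hdet with hd | hd
    · left
      have : h.val 0 0 * h.val 1 1 = h.val 0 1 * h.val 1 0 + 1 := by linarith
      show ((h.val 0 0 : ℤ) : ℚ) * ((h.val 1 1 : ℤ) : ℚ) = (h.val 0 1 : ℤ) * (h.val 1 0 : ℤ) + 1
      exact_mod_cast this
    · right
      have : h.val 0 0 * h.val 1 1 + 1 = h.val 0 1 * h.val 1 0 := by linarith
      show ((h.val 0 0 : ℤ) : ℚ) * ((h.val 1 1 : ℤ) : ℚ) + 1 = (h.val 0 1 : ℤ) * (h.val 1 0 : ℤ)
      exact_mod_cast this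
  · rintro ⟨⟨a, b, c, d, ha, hb, hc, hd⟩, h⟩
    rw [ha, hb, hc, hd] at h
    have hu : IsUnit (!![a, b; c, d] : Matrix (Fin 2) (Fin 2) ℤ) := by
      rw [Matrix.isUnit_iff_isUnit_det, Matrix.det_fin_two_of, Int.isUnit_iff]
      rcases h with h | h
      · left; have : a * d = b * c + 1 := by exact_mod_cast h
        linarith
      · right; have : a * d + 1 = b * c := by exact_mod_cast h
        linarith
    obtain ⟨u, hu⟩ := hu
    refine ⟨u, ?_⟩
    ext i j
    change ((u.val i j : ℤ) : ℚ) = g.val i j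
    rw [hu]
    fin_cases i <;> fin_cases j <;> simp [ha, hb, hc, hd]

theorem primrecPred_mem_GL2Z : PrimrecPred fun g : GL (Fin 2) ℚ => g ∈ GL2Z := by
  have a1 := Primrec.fst.comp (Primrec.fst.comp primrec_entries)
  have b1 := Primrec.snd.comp (Primrec.fst.comp primrec_entries)
  have c1 := Primrec.fst.comp (Primrec.snd.comp primrec_entries)
  have d1 := Primrec.snd.comp (Primrec.snd.comp primrec_entries)
  have int {f : GL (Fin 2) ℚ → ℚ} (hf : Primrec f) : PrimrecPred fun g => (f g).den = 1 :=
    Primrec.eq.comp (primrec_den.comp hf) (Primrec.const 1)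
  have ad := primrec_rat_mul.comp a1 d1
  have bc := primrec_rat_mul.comp b1 c1
  refine (((int a1).and ((int b1).and ((int c1).and (int d1)))).and (PrimrecPred.or
    (Primrec.eq.comp ad (primrec_rat_add.comp bc (Primrec.const 1)))
    (Primrec.eq.comp (primrec_rat_add.comp ad (Primrec.const 1)) bc))).of_eq fun g => ?_
  rw [mem_GL2Z_iff]
  simp only [← rat_exists_int_iff]
  refine and_congr_left fun _ => ?_
  constructor
  · rintro ⟨⟨a, ha⟩, ⟨b, hb⟩, ⟨c, hc⟩, ⟨d, hd⟩⟩
    exact ⟨a, b, c, d, ha, hb, hc, hd⟩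
  · rintro ⟨a, b, c, d, ha, hb, hc, hd⟩
    exact ⟨⟨a, ha⟩, ⟨b, hb⟩, ⟨c, hc⟩, ⟨d, hd⟩⟩

end MatrixCoding

/-! ### The Sanov subgroup: freeness and description by congruences. -/

section Sanov

/-- The two unipotent generators of the Sanov subgroup. -/
noncomputable def sanovGen (i : Bool) : GL (Fin 2) ℚ :=
  Matrix.GeneralLinearGroup.mkOfDetNeZero (if i then !![1, 2; 0, 1] else !![1, 0; 2, 1])
    (by cases i <;> simp [Matrix.det_fin_two_of])

/-- The homomorphism from the free group of rank two onto the Sanov subgroup. -/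
noncomputable def sanov : FreeGroup Bool →* GL (Fin 2) ℚ := FreeGroup.lift sanovGen

/-- The matrix of a letter. -/
noncomputable def sanovLetter (x : Bool × Bool) : GL (Fin 2) ℚ := sanov (FreeGroup.mk [x])

/-- The sign of a letter. -/
def letterSign (x : Bool × Bool) : ℚ := if x.2 then 1 else -1

theorem sanovLetter_val (x : Bool × Bool) : (sanovLetter x).val =
    if x.1 then !![1, 2 * letterSign x; 0, 1] else !![1, 0; 2 * letterSign x, 1] := by
  obtain ⟨i, s⟩ := x
  cases s
  · have h : sanovLetter (i, false) = (sanovGen i)⁻¹ := by simp [sanovLetter, sanov]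
    rw [h, Matrix.coe_units_inv]
    cases i <;> simp [sanovGen, letterSign, Matrix.GeneralLinearGroup.mkOfDetNeZero,
      Matrix.inv_def, Matrix.adjugate_fin_two_of]
  · have h : sanovLetter (i, true) = sanovGen i := by simp [sanovLetter, sanov]
    rw [h]
    cases i <;> simp [sanovGen, letterSign, Matrix.GeneralLinearGroup.mkOfDetNeZero]

theorem sanov_mk_cons (x : Bool × Bool) (L : List (Bool × Bool)) :
    sanov (FreeGroup.mk (x :: L)) = sanovLetter x * sanov (FreeGroup.mk L) := by
  rw [sanovLetter, ← map_mul, FreeGroup.mul_mk]; rfl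

/-- The action of a letter on vectors. -/
def letterAct (x : Bool × Bool) (v : ℚ × ℚ) : ℚ × ℚ :=
  if x.1 then (v.1 + 2 * letterSign x * v.2, v.2) else (v.1, 2 * letterSign x * v.1 + v.2)

/-- The cone that a letter maps the cones of all other letters but its inverse into. -/
def letterCone (x : Bool × Bool) (v : ℚ × ℚ) : Prop :=
  0 < letterSign x * (v.1 * v.2) ∧ if x.1 then v.2 ^ 2 < v.1 ^ 2 else v.1 ^ 2 < v.2 ^ 2

/-- The ping-pong step; the hypothesis excludes only that `x` and `y` are mutually inverse. If they
act on different coordinates, adding twice the larger coordinate to the smaller one reverses their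
order and fixes the sign of the product. If they are equal, the sign in the cone prevents
cancellation. -/
theorem letterCone_act {x y : Bool × Bool} (h : x.1 = y.1 → x.2 = y.2) {v : ℚ × ℚ}
    (hv : letterCone y v) : letterCone x (letterAct x v) := by
  obtain ⟨i, s⟩ := x
  obtain ⟨j, t⟩ := y
  obtain ⟨p, q⟩ := v
  have e1 := sq_nonneg (p + q)
  have e2 := sq_nonneg (p - q)
  cases i <;> cases s <;> cases j <;> cases t <;>
    simp [letterCone, letterAct, letterSign] at h hv ⊢ <;> constructor <;> nlinarith

/-- The starting vector is the basis vector that the last letter `x` does not fix; `x` moves it into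
its own cone, and the remaining letters play ping-pong. -/
theorem letterCone_foldr {L : List (Bool × Bool)} (x : Bool × Bool) :
    ∀ y, FreeGroup.IsReduced (y :: L) → (y :: L).getLast (by simp) = x →
      letterCone y ((y :: L).foldr letterAct (if x.1 then (0, 1) else (1, 0))) := by
  induction L with
  | nil =>
    rintro y - rfl
    obtain ⟨i, s⟩ := y
    cases i <;> cases s <;> simp [letterCone, letterAct, letterSign]
  | cons z L ih =>
    intro y hy hx
    rw [List.getLast_cons (by simp)] at hx
    rw [FreeGroup.isReduced_cons_cons] at hy
    rw [List.foldr_cons]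
    exact letterCone_act hy.1 (ih z hy.2 hx)

theorem foldr_letterAct (L : List (Bool × Bool)) (v : ℚ × ℚ) : L.foldr letterAct v =
    ((sanov (FreeGroup.mk L)).val 0 0 * v.1 + (sanov (FreeGroup.mk L)).val 0 1 * v.2,
      (sanov (FreeGroup.mk L)).val 1 0 * v.1 + (sanov (FreeGroup.mk L)).val 1 1 * v.2) := by
  induction L with
  | nil => rw [← FreeGroup.one_eq_mk, map_one]; simp
  | cons x L ih =>
    rw [List.foldr_cons, ih, sanov_mk_cons, Units.val_mul, sanovLetter_val, letterAct]
    split_ifs <;> simp [Matrix.mul_apply, Fin.sum_univ_two] <;> ring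

/-- A nontrivial reduced word moves a basis vector into a cone, where the product of the coordinates
is nonzero; so it does not act as the identity. -/
theorem sanov_injective : Function.Injective sanov := by
  rw [injective_iff_map_eq_one]
  intro f hf
  by_contra hne
  rcases hL : f.toWord with _ | ⟨y, L⟩
  · exact hne (FreeGroup.toWord_eq_nil_iff.1 hL)
  have hred : FreeGroup.IsReduced (y :: L) := hL ▸ FreeGroup.isReduced_toWord
  obtain ⟨x, hx⟩ : ∃ x, (y :: L).getLast (by simp) = x := ⟨_, rfl⟩
  have h := letterCone_foldr x y hred hx
  rw [foldr_letterAct, ← hL, FreeGroup.mk_toWord, hf] at h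
  have h1 := h.1
  split_ifs at h1 <;> simp at h1

theorem sanovLetter_mul_val (x : Bool × Bool) (g : GL (Fin 2) ℚ) : (sanovLetter x * g).val =
    if x.1 then !![g.val 0 0 + 2 * letterSign x * g.val 1 0,
      g.val 0 1 + 2 * letterSign x * g.val 1 1; g.val 1 0, g.val 1 1]
    else !![g.val 0 0, g.val 0 1; 2 * letterSign x * g.val 0 0 + g.val 1 0,
      2 * letterSign x * g.val 0 1 + g.val 1 1] := by
  rw [Units.val_mul, sanovLetter_val]
  split_ifs <;> ext i j <;> fin_cases i <;> fin_cases j <;>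
    simp [Matrix.mul_apply, Fin.sum_univ_two]

theorem IsSanov.letter_mul {g : GL (Fin 2) ℚ} (hg : IsSanov g) (x : Bool × Bool) :
    IsSanov (sanovLetter x * g) := by
  obtain ⟨a, b, c, d, ha, hb, hc, hd, h⟩ := hg
  obtain ⟨e, he⟩ : ∃ e : ℤ, letterSign x = e := by
    unfold letterSign; split_ifs; exacts [⟨1, by simp⟩, ⟨-1, by simp⟩]
  unfold IsSanov
  rw [sanovLetter_mul_val, he]
  split_ifs
  · refine ⟨a + e * c, b + e * (1 + 4 * d), c, d, ?_, ?_, ?_, ?_, ?_⟩ <;>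
      simp [ha, hb, hc, hd] at h ⊢ <;> first | ring1 | linear_combination h
  · refine ⟨a, b, c + e * (1 + 4 * a), d + e * b, ?_, ?_, ?_, ?_, ?_⟩ <;>
      simp [ha, hb, hc, hd] at h ⊢ <;> first | ring1 | linear_combination h

theorem isSanov_sanov (f : FreeGroup Bool) : IsSanov (sanov f) := by
  rw [← FreeGroup.mk_toWord (x := f)]
  induction f.toWord with
  | nil =>
    rw [← FreeGroup.one_eq_mk, map_one]
    exact ⟨0, 0, 0, 0, by simp, by simp, by simp, by simp, by simp⟩
  | cons x L ih => rw [sanov_mk_cons]; exact ih.letter_mul x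

theorem mem_range_of_letter_mul {x : Bool × Bool} {g : GL (Fin 2) ℚ}
    (h : sanovLetter x * g ∈ sanov.range) : g ∈ sanov.range :=
  (Subgroup.mul_mem_cancel_left sanov.range (MonoidHom.mem_range.2 ⟨FreeGroup.mk [x], rfl⟩)).1 h

/-- Euclidean descent on the first column `(1 + 4a, 2c)`: adding or subtracting twice the entry of
smaller absolute value shrinks the other one, as long as the smaller one is nonzero. -/
theorem IsSanov.mem_range {g : GL (Fin 2) ℚ} (hg : IsSanov g) : g ∈ sanov.range := by
  suffices H : ∀ n : ℕ, ∀ g : GL (Fin 2) ℚ, ∀ a b c d : ℤ, (1 + 4 * a).natAbs + (2 * c).natAbs = n →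
      g.val = !![1 + 4 * (a : ℚ), 2 * (b : ℚ); 2 * (c : ℚ), 1 + 4 * (d : ℚ)] →
      (1 + 4 * a) * (1 + 4 * d) = 2 * b * (2 * c) + 1 → g ∈ sanov.range by
    obtain ⟨a, b, c, d, ha, hb, hc, hd, h⟩ := hg
    refine H _ g a b c d rfl ?_ ?_
    · ext i j; fin_cases i <;> fin_cases j <;> simp [ha, hb, hc, hd]
    · rw [ha, hb, hc, hd] at h; exact_mod_cast h
  intro n
  induction n using Nat.strong_induction_on with
  | _ n ih =>
    rintro g a b c d rfl hg h
    have key : ∀ x : Bool × Bool, ∀ e : ℤ, letterSign x = e →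
        (if x.1 then (1 + 4 * (a + e * c)).natAbs < (1 + 4 * a).natAbs
          else (2 * (c + e * (1 + 4 * a))).natAbs < (2 * c).natAbs) → g ∈ sanov.range := by
      intro x e he hlt
      refine mem_range_of_letter_mul (x := x) ?_
      have hv := sanovLetter_mul_val x g
      rw [he, hg] at hv
      split_ifs at hv hlt
      · refine ih _ ?_ _ (a + e * c) (b + e * (1 + 4 * d)) c d rfl ?_ ?_
        · omega
        · rw [hv]; ext i j; fin_cases i <;> fin_cases j <;> simp <;> ring
        · linear_combination h
      · refine ih _ ?_ _ a b (c + e * (1 + 4 * a)) (d + e * b) rfl ?_ ?_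
        · omega
        · rw [hv]; ext i j; fin_cases i <;> fin_cases j <;> simp <;> ring
        · linear_combination h
    rcases lt_trichotomy (1 + 4 * a).natAbs (2 * c).natAbs with hlt | heq | hlt
    · by_cases hs : 0 < c ↔ 0 < 1 + 4 * a
      · exact key (false, false) (-1) (by simp [letterSign]) (by simp; omega)
      · exact key (false, true) 1 (by simp [letterSign]) (by simp; omega)
    -- An odd and an even number never have the same absolute value.
    · omega
    · rcases eq_or_ne c 0 with rfl | hc
      -- The end of the descent: the diagonal entries are units congruent to 1 modulo 4, hence both
      -- 1, and the matrix is a power of the upper generator.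
      · obtain rfl : a = 0 := by
          have h1 : (1 + 4 * a) * (1 + 4 * d) = 1 := by linarith
          have := Int.isUnit_iff.1 (IsUnit.of_mul_eq_one _ h1)
          omega
        obtain rfl : d = 0 := by omega
        have hz : sanovGen true ^ b = g := by
          have hpow : ∀ k : ℕ, ((sanovGen true) ^ k).val = !![1, 2 * (k : ℚ); 0, 1] := by
            intro k
            induction k with
            | zero => ext i j; fin_cases i <;> fin_cases j <;> simp
            | succ k ihk =>
              rw [pow_succ, Units.val_mul, ihk]
              ext i j
              fin_cases i <;> fin_cases j <;>
                simp [sanovGen, Matrix.GeneralLinearGroup.mkOfDetNeZero, Matrix.mul_apply,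
                  Fin.sum_univ_two]
              ring
          rcases Int.eq_nat_or_neg b with ⟨k, rfl | rfl⟩
          · rw [zpow_natCast]
            ext i j
            rw [hpow, hg]
            fin_cases i <;> fin_cases j <;> simp
          · rw [zpow_neg, zpow_natCast, inv_eq_iff_mul_eq_one]
            ext i j
            rw [Units.val_mul, hpow, hg]
            fin_cases i <;> fin_cases j <;> simp [Matrix.mul_apply, Fin.sum_univ_two]
        rw [← hz]
        exact ⟨FreeGroup.of true ^ b, by simp [sanov]⟩
      · by_cases hs : 0 < c ↔ 0 < 1 + 4 * a
        · exact key (true, false) (-1) (by simp [letterSign]) (by simp; omega)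
        · exact key (true, true) 1 (by simp [letterSign]) (by simp; omega)

theorem isSanov_iff (g : GL (Fin 2) ℚ) : IsSanov g ↔ ∃ f, sanov f = g :=
  ⟨fun h => h.mem_range, by rintro ⟨f, rfl⟩; exact isSanov_sanov f⟩

end Sanov

/-! ### Saturated automata over a group with a free subgroup. -/

section Automata

variable {G : Type*} [Group G]

/-- `Path E p g q` says that the automaton with the list of labelled edges `E` has a path from
`p` to `q` whose labels multiply to `g`. -/
inductive Path (E : List (ℕ × G × ℕ)) : ℕ → G → ℕ → Prop
  | nil (p : ℕ) : Path E p 1 p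
  | cons {p q r : ℕ} {g h : G} : (p, g, q) ∈ E → Path E q h r → Path E p (g * h) r

namespace Path

variable {E : List (ℕ × G × ℕ)} {p q r : ℕ} {g h : G}

theorem single (he : (p, g, q) ∈ E) : Path E p g q := by
  simpa using Path.cons he (Path.nil q)

theorem trans (h₁ : Path E p g q) (h₂ : Path E q h r) : Path E p (g * h) r := by
  induction h₁ with
  | nil p => simpa using h₂
  | cons he _ ih => rw [mul_assoc]; exact Path.cons he (ih h₂)

/-- A family of sets that is compatible with the edges contains the labels of all paths. -/
theorem mem_of_invariant (hp : Path E p g q) {Y : ℕ → Set G}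
    (hY : ∀ e ∈ E, ∀ x ∈ Y e.1, x * e.2.1 ∈ Y e.2.2) {x : G} (hx : x ∈ Y p) : x * g ∈ Y q := by
  induction hp generalizing x with
  | nil p => simpa using hx
  | cons he _ ih => rw [← mul_assoc]; exact ih (hY _ he _ hx)

theorem map {E' : List (ℕ × G × ℕ)} (hp : Path E p g q) (i : ℕ → ℕ)
    (hi : ∀ e ∈ E, (i e.1, e.2.1, i e.2.2) ∈ E') : Path E' (i p) g (i q) := by
  induction hp with
  | nil p => exact Path.nil _
  | cons he _ ih => exact Path.cons (hi _ he) ih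

end Path

open Classical in
/-- Adds all compositions of two facts to a list of facts `(p, g, q)`. -/
noncomputable def compose (S : List (ℕ × G × ℕ)) : List (ℕ × G × ℕ) :=
  S ++ S.flatMap fun x => (S.filter fun y => y.1 = x.2.2).map fun y =>
    (x.1, x.2.1 * y.2.1, y.2.2)

/-- The facts derived in `k` rounds from the edges of `E`, starting with trivial loops at the
states that occur in `V`. -/
noncomputable def facts (E : List (ℕ × G × ℕ)) (V : List (ℕ × ℕ × G)) (k : ℕ) :
    List (ℕ × G × ℕ) :=
  compose^[k] (E ++ V.map fun v => (v.2.1, 1, v.2.1))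

/-- A vertex `(p, y)` stands for the elements `φ f * y` that are read on arrival at state `p`.
`Rel S u o v` says that some fact of `S` leads from `u` to `v` while producing `o`. -/
def Rel (S : List (ℕ × G × ℕ)) (u : ℕ × G) (o : G) (v : ℕ × G) : Prop :=
  ∃ s ∈ S, s.1 = u.1 ∧ s.2.2 = v.1 ∧ u.2 * s.2.1 = o * v.2

theorem mem_compose {S : List (ℕ × G × ℕ)} {s : ℕ × G × ℕ} : s ∈ compose S ↔
    s ∈ S ∨ ∃ x ∈ S, ∃ y ∈ S, y.1 = x.2.2 ∧ s = (x.1, x.2.1 * y.2.1, y.2.2) := by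
  simp only [compose, List.mem_append, List.mem_flatMap, List.mem_map, List.mem_filter,
    decide_eq_true_eq]
  constructor
  · rintro (h | ⟨x, hx, y, ⟨hy, he⟩, rfl⟩)
    exacts [Or.inl h, Or.inr ⟨x, hx, y, hy, he, rfl⟩]
  · rintro (h | ⟨x, hx, y, hy, he, rfl⟩)
    exacts [Or.inl h, Or.inr ⟨x, hx, y, ⟨hy, he⟩, rfl⟩]

theorem facts_succ (E : List (ℕ × G × ℕ)) (V : List (ℕ × ℕ × G)) (k : ℕ) :
    facts E V (k + 1) = compose (facts E V k) := by
  simp only [facts, Function.iterate_succ', Function.comp]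

theorem facts_mono (E : List (ℕ × G × ℕ)) (V : List (ℕ × ℕ × G)) {k l : ℕ} (h : k ≤ l)
    {s : ℕ × G × ℕ} (hs : s ∈ facts E V k) : s ∈ facts E V l := by
  induction h with
  | refl => exact hs
  | step _ ih => rw [facts_succ]; exact mem_compose.2 (Or.inl ih)

theorem path_of_mem_facts {E : List (ℕ × G × ℕ)} {V : List (ℕ × ℕ × G)} {k : ℕ}
    {s : ℕ × G × ℕ} (hs : s ∈ facts E V k) : Path E s.1 s.2.1 s.2.2 := by
  induction k generalizing s with
  | zero =>
    simp only [facts, Function.iterate_zero, id, List.mem_append, List.mem_map] at hs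
    rcases hs with hs | ⟨v, _, rfl⟩
    · exact Path.single hs
    · exact Path.nil _
  | succ k ih =>
    rw [facts_succ, mem_compose] at hs
    rcases hs with hs | ⟨x, hx, y, hy, he, rfl⟩
    · exact ih hs
    · exact (ih hx).trans (he ▸ ih hy)

/-- The path is assembled from its end, so a trivial loop is needed only at its last state. -/
theorem exists_mem_facts {E : List (ℕ × G × ℕ)} {V : List (ℕ × ℕ × G)} {p q : ℕ} {g : G}
    (hp : Path E p g q) (hq : ∃ v ∈ V, v.2.1 = q) : ∃ k, (p, g, q) ∈ facts E V k := by
  induction hp with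
  | nil p =>
    obtain ⟨v, hv, rfl⟩ := hq
    exact ⟨0, List.mem_append_right _ (List.mem_map.2 ⟨v, hv, rfl⟩)⟩
  | @cons p q r g h he _ ih =>
    obtain ⟨k, hk⟩ := ih hq
    refine ⟨k + 1, ?_⟩
    rw [facts_succ]
    refine mem_compose.2 (Or.inr ⟨(p, g, q), ?_, _, hk, rfl, rfl⟩)
    exact facts_mono E V (Nat.zero_le k) (List.mem_append_left _ he)

/-- Soundness: derived relations always come from genuine paths, whether or not the certificate is
valid. -/
theorem path_of_rel {E : List (ℕ × G × ℕ)} {V : List (ℕ × ℕ × G)} {k : ℕ} {u v : ℕ × G} {o : G}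
    (h : Rel (facts E V k) u o v) : Path E u.1 (u.2⁻¹ * o * v.2) v.1 := by
  obtain ⟨s, hs, h1, h2, h3⟩ := h
  have := path_of_mem_facts hs
  rwa [h1, h2, eq_inv_mul_of_mul_eq h3, ← mul_assoc] at this

/-- The letters of the free group of rank two. -/
def letters : List (Bool × Bool) := [(true, true), (true, false), (false, true), (false, false)]

theorem mem_letters (x : Bool × Bool) : x ∈ letters := by
  obtain ⟨i, s⟩ := x
  cases i <;> cases s <;> simp [letters]

variable (φ : FreeGroup Bool →* G) (C : G → Prop)

/-- The group element of a letter. -/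
def letterVal (x : Bool × Bool) : G := φ (FreeGroup.mk [x])

/-- The elements of length at most one of the free group. -/
def labels : List G := 1 :: letters.map (letterVal φ)

theorem one_mem_labels : (1 : G) ∈ labels φ := List.mem_cons_self

theorem letterVal_mem_labels (x : Bool × Bool) : letterVal φ x ∈ labels φ :=
  List.mem_cons_of_mem _ (List.mem_map.2 ⟨x, mem_letters x, rfl⟩)

theorem map_mk_cons (x : Bool × Bool) (l : List (Bool × Bool)) :
    φ (FreeGroup.mk (x :: l)) = letterVal φ x * φ (FreeGroup.mk l) := by
  rw [letterVal, ← map_mul, FreeGroup.mul_mk]; rfl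

theorem letterVal_mul_not (x : Bool × Bool) : letterVal φ x * letterVal φ (x.1, !x.2) = 1 := by
  rw [letterVal, letterVal, ← map_mul, FreeGroup.mul_mk,
    ← map_one φ, FreeGroup.one_eq_mk]
  congr 1
  exact Quot.sound (by simpa using FreeGroup.Red.Step.cons_not (L := []) (x := x.1) (b := x.2))

/-- The vertices of `V` (triples of a rank, a state and a group element) describe faithfully how
the elements read by the automaton `E` with the starting states `pair a 0`, `a ∈ A`, move among
the right cosets of the image of `φ`, where `S` is the list of facts in use. -/
structure IsSaturated (E : List (ℕ × G × ℕ)) (A : List ℕ) (V : List (ℕ × ℕ × G))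
    (S : List (ℕ × G × ℕ)) (I : List G) : Prop where
  comp : ∀ o₁ ∈ labels φ, ∀ o₂ ∈ labels φ, ∀ o₃ ∈ labels φ, o₁ * o₂ = o₃ →
    ∀ u ∈ V, ∀ v ∈ V, ∀ w ∈ V, Rel S u.2 o₁ v.2 → Rel S v.2 o₂ w.2 → Rel S u.2 o₃ w.2
  descend : ∀ v ∈ V, v.1 = 0 ∨ ∃ v' ∈ V, ∃ x ∈ letters,
    v'.1 + 1 = v.1 ∧ v'.2.1 = v.2.1 ∧ v.2.2 = letterVal φ x * v'.2.2
  closed : ∀ v ∈ V, v.1 = 0 → ∀ e ∈ E, e.1 = v.2.1 →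
    ∃ v' ∈ V, v'.2.1 = e.2.2 ∧ v'.2.2 = v.2.2 * e.2.1
  start : ∀ a ∈ A, (0, Nat.pair a 0, 1) ∈ V
  separated : ∀ v ∈ V, ∀ v' ∈ V, v.1 = 0 → v'.1 = 0 →
    v.2.2 = v'.2.2 ∨ ∃ x ∈ I, x * v'.2.2 = v.2.2 ∧ ¬ C x

/-- A run through the vertices of `V` that produces the given word. -/
def RelWord (V : List (ℕ × ℕ × G)) (S : List (ℕ × G × ℕ)) :
    ℕ × G → List (Bool × Bool) → ℕ × G → Prop
  | u, [], v => Rel S u 1 v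
  | u, x :: l, v => ∃ m ∈ V, Rel S u (letterVal φ x) m.2 ∧ RelWord V S m.2 l v

variable {φ C} {E : List (ℕ × G × ℕ)} {A : List ℕ} {V : List (ℕ × ℕ × G)} {k : ℕ} {I : List G}

theorem rel_one_of_edge {v : ℕ × ℕ × G} {e : ℕ × G × ℕ} (he : e ∈ E) (hv : e.1 = v.2.1) :
    Rel (facts E V k) v.2 1 (e.2.2, v.2.2 * e.2.1) :=
  ⟨e, facts_mono E V (Nat.zero_le k) (List.mem_append_left _ he), hv, rfl, by simp⟩

theorem rel_of_mul {v : ℕ × ℕ × G} (hv : v ∈ V) {o : G} {p : ℕ} {y : G} (hp : v.2.1 = p)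
    (hy : y = o * v.2.2) : Rel (facts E V k) (p, y) o v.2 :=
  ⟨(v.2.1, 1, v.2.1), facts_mono E V (Nat.zero_le k) (List.mem_append_right _
    (List.mem_map.2 ⟨v, hv, rfl⟩)), hp, rfl, by simp [hy]⟩

namespace IsSaturated

theorem relWord_of_rel_one (hs : IsSaturated φ C E A V (facts E V k) I)
    {u m v : ℕ × ℕ × G} (hu : u ∈ V) (hm : m ∈ V) (hv : v ∈ V)
    (h : Rel (facts E V k) u.2 1 m.2) {l : List (Bool × Bool)}
    (hl : RelWord φ V (facts E V k) m.2 l v.2) : RelWord φ V (facts E V k) u.2 l v.2 := by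
  cases l with
  | nil =>
    exact hs.comp 1 (one_mem_labels φ) 1 (one_mem_labels φ) 1 (one_mem_labels φ) (mul_one 1)
      u hu m hm v hv h hl
  | cons x l =>
    obtain ⟨m', hm', h1, h2⟩ := hl
    exact ⟨m', hm', hs.comp 1 (one_mem_labels φ) _ (letterVal_mem_labels φ x) _
      (letterVal_mem_labels φ x) (one_mul _) u hu m hm m' hm' h h1, h2⟩

/-- The heart of Benois' argument. A letter put in front of a reduced word either extends it or
cancels its first letter; in the second case the two relations compose to one that produces nothing.
-/
theorem relWord_of_rel_letter (hs : IsSaturated φ C E A V (facts E V k) I)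
    {u m v : ℕ × ℕ × G} (hu : u ∈ V) (hm : m ∈ V) (hv : v ∈ V)
    {x : Bool × Bool} (h : Rel (facts E V k) u.2 (letterVal φ x) m.2) {f : FreeGroup Bool}
    (hl : RelWord φ V (facts E V k) m.2 f.toWord v.2) :
    RelWord φ V (facts E V k) u.2 (FreeGroup.mk [x] * f).toWord v.2 := by
  have hw : (FreeGroup.mk [x] * f).toWord = FreeGroup.reduce (x :: f.toWord) := by
    conv_lhs => rw [← FreeGroup.mk_toWord (x := f), FreeGroup.mul_mk, FreeGroup.toWord_mk]
    rfl
  rw [hw, FreeGroup.reduce.cons, FreeGroup.reduce_toWord]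
  rcases hf : f.toWord with _ | ⟨y, l⟩
  · rw [hf] at hl
    exact ⟨m, hm, h, hl⟩
  · rw [hf] at hl
    simp only
    split_ifs with hxy
    · obtain ⟨m', hm', h1, h2⟩ := hl
      have hy : y = (x.1, !x.2) := by
        obtain ⟨h3, h4⟩ := hxy
        ext
        · exact h3.symm
        · simp [h4]
      refine hs.relWord_of_rel_one hu hm' hv ?_ h2
      exact hs.comp _ (letterVal_mem_labels φ x) _ (letterVal_mem_labels φ y) 1 (one_mem_labels φ)
        (by rw [hy]; exact letterVal_mul_not φ x) u hu m hm m' hm' h h1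
    · exact ⟨m, hm, h, hl⟩

/-- A vertex of rank `n` spells out `n` letters on its way down to rank zero without changing its
state, so a run from the bottom can be prolonged to one from the vertex, with reduction. -/
theorem exists_rank_zero (hs : IsSaturated φ C E A V (facts E V k) I) (n : ℕ) :
    ∀ v ∈ V, v.1 = n → ∃ f : FreeGroup Bool, ∃ t,
    (0, v.2.1, t) ∈ V ∧ v.2.2 = φ f * t ∧ ∀ w ∈ V, ∀ f' : FreeGroup Bool,
      RelWord φ V (facts E V k) (v.2.1, t) f'.toWord w.2 →
        RelWord φ V (facts E V k) v.2 (f * f').toWord w.2 := by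
  induction n with
  | zero =>
    rintro ⟨_, p, y⟩ hv rfl
    exact ⟨1, y, hv, by simp, fun w hw f' h => by simpa using h⟩
  | succ n ih =>
    intro v hv hn
    rcases hs.descend v hv with h0 | ⟨v', hv', x, -, h1, h2, h3⟩
    · omega
    obtain ⟨f, t, ht, hy, hf⟩ := ih v' hv' (by omega)
    refine ⟨FreeGroup.mk [x] * f, t, h2 ▸ ht, ?_, fun w hw f' h => ?_⟩
    · rw [h3, hy, map_mul, mul_assoc]; rfl
    · rw [mul_assoc]
      exact hs.relWord_of_rel_letter hv hv' hw (rel_of_mul hv' h2 h3) (hf w hw f' (h2 ▸ h))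

/-- Completeness. Each edge leads silently from rank zero to a vertex of some rank; descending from
there to rank zero produces the free group element that the edge contributes. -/
theorem exists_relWord (hs : IsSaturated φ C E A V (facts E V k) I)
    {p q : ℕ} {g : G} (hp : Path E p g q) : ∀ t, (0, p, t) ∈ V →
    ∃ f : FreeGroup Bool, ∃ t', (0, q, t') ∈ V ∧ t * g = φ f * t' ∧
      RelWord φ V (facts E V k) (p, t) f.toWord (q, t') := by
  induction hp with
  | nil p =>
    intro t ht
    refine ⟨1, t, ht, by simp, ?_⟩
    rw [FreeGroup.toWord_one]
    exact rel_of_mul (v := (0, p, t)) ht rfl (by simp)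
  | @cons p q r g h he _ ih =>
    intro t ht
    obtain ⟨v, hv, h1, h2⟩ := hs.closed _ ht rfl _ he rfl
    obtain ⟨f, t', ht', hy, hf⟩ := hs.exists_rank_zero _ v hv rfl
    simp only at h1 h2
    obtain ⟨f', t'', ht'', hy', hr⟩ := ih t' (h1 ▸ ht')
    refine ⟨f * f', t'', ht'', ?_, ?_⟩
    · rw [← mul_assoc, ← h2, hy, mul_assoc, hy', map_mul, mul_assoc]
    · refine hs.relWord_of_rel_one (u := (0, p, t)) (v := (0, r, t'')) ht hv ht'' ?_
        (hf (0, r, t'') ht'' f' (h1 ▸ hr))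
      have := rel_one_of_edge (k := k) (V := V) (v := (0, p, t)) he rfl
      simp only at this
      rwa [← h1, ← h2] at this

end IsSaturated

variable (φ)

open Classical in
/-- The vertices reached from those of `D` while producing the letter `x`. -/
noncomputable def nextSet (V : List (ℕ × ℕ × G)) (S : List (ℕ × G × ℕ))
    (D : List (ℕ × G)) (x : Bool × Bool) : List (ℕ × G) :=
  (V.map Prod.snd).filter fun v => ∃ u ∈ D, Rel S u (letterVal φ x) v

open Classical in
/-- The vertices reached from the starting vertices while producing nothing. -/
noncomputable def startSet (A : List ℕ) (V : List (ℕ × ℕ × G)) (S : List (ℕ × G × ℕ)) :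
    List (ℕ × G) :=
  (V.map Prod.snd).filter fun v => ∃ a ∈ A, Rel S (Nat.pair a 0, 1) 1 v

/-- The vertices reached from the starting vertices while producing the word `l`. -/
noncomputable def wordSet (A : List ℕ) (V : List (ℕ × ℕ × G)) (S : List (ℕ × G × ℕ))
    (l : List (Bool × Bool)) : List (ℕ × G) :=
  l.foldl (nextSet φ V S) (startSet A V S)

theorem mem_nextSet {V : List (ℕ × ℕ × G)} {S : List (ℕ × G × ℕ)} {D : List (ℕ × G)}
    {x : Bool × Bool} {v : ℕ × G} : v ∈ nextSet φ V S D x ↔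
      (∃ n, (n, v) ∈ V) ∧ ∃ u ∈ D, Rel S u (letterVal φ x) v := by
  simp [nextSet]

theorem mem_startSet {A : List ℕ} {V : List (ℕ × ℕ × G)} {S : List (ℕ × G × ℕ)} {v : ℕ × G} :
    v ∈ startSet A V S ↔ (∃ n, (n, v) ∈ V) ∧ ∃ a ∈ A, Rel S (Nat.pair a 0, 1) 1 v := by
  simp [startSet]

theorem wordSet_concat (A : List ℕ) (V : List (ℕ × ℕ × G)) (S : List (ℕ × G × ℕ))
    (l : List (Bool × Bool)) (x : Bool × Bool) :
    wordSet φ A V S (l ++ [x]) = nextSet φ V S (wordSet φ A V S l) x := by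
  simp [wordSet]

variable {φ}

theorem path_of_mem_wordSet {l : List (Bool × Bool)} {v : ℕ × G}
    (hv : v ∈ wordSet φ A V (facts E V k) l) :
    ∃ a ∈ A, Path E (Nat.pair a 0) (φ (FreeGroup.mk l) * v.2) v.1 := by
  induction l using List.reverseRecOn generalizing v with
  | nil =>
    obtain ⟨-, a, ha, h⟩ := mem_startSet.1 hv
    refine ⟨a, ha, ?_⟩
    simpa [← FreeGroup.one_eq_mk] using path_of_rel h
  | append_singleton l x ih =>
    rw [wordSet_concat, mem_nextSet] at hv
    obtain ⟨-, u, hu, h⟩ := hv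
    obtain ⟨a, ha, hp⟩ := ih hu
    refine ⟨a, ha, ?_⟩
    convert hp.trans (path_of_rel h) using 1
    rw [← FreeGroup.mul_mk, map_mul, letterVal]
    group

/-- The invariant is that the current set is closed under silent moves; composition with relations
that produce nothing preserves it from letter to letter. -/
theorem IsSaturated.mem_foldl (hs : IsSaturated φ C E A V (facts E V k) I)
    {l : List (Bool × Bool)} {v : ℕ × ℕ × G} (hv : v ∈ V) :
    ∀ {D : List (ℕ × G)} {m : ℕ × G},
      (∀ u ∈ D, (∃ n, (n, u) ∈ V) ∧ ∀ w ∈ V, Rel (facts E V k) u 1 w.2 → w.2 ∈ D) → m ∈ D →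
      RelWord φ V (facts E V k) m l v.2 → v.2 ∈ l.foldl (nextSet φ V (facts E V k)) D := by
  induction l with
  | nil =>
    intro D m hD hm h
    exact (hD m hm).2 v hv h
  | cons x l ih =>
    rintro D m hD hm ⟨m', hm', h1, h2⟩
    rw [List.foldl_cons]
    refine ih ?_ ((mem_nextSet φ).2 ⟨⟨_, hm'⟩, m, hm, h1⟩) h2
    intro u hu
    obtain ⟨⟨n, hn⟩, z, hz, hzu⟩ := (mem_nextSet φ).1 hu
    refine ⟨⟨n, hn⟩, fun w hw huw => (mem_nextSet φ).2 ⟨⟨_, hw⟩, z, hz, ?_⟩⟩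
    obtain ⟨i, hi⟩ := (hD z hz).1
    exact hs.comp _ (letterVal_mem_labels φ x) 1 (one_mem_labels φ) _ (letterVal_mem_labels φ x)
      (mul_one _) _ hi _ hn w hw hzu huw

theorem IsSaturated.mem_wordSet_of_path (hs : IsSaturated φ C E A V (facts E V k) I) {a q : ℕ}
    (ha : a ∈ A) {x : G} (hp : Path E (Nat.pair a 0) x q) : ∃ f : FreeGroup Bool, ∃ t,
      (0, q, t) ∈ V ∧ x = φ f * t ∧ (q, t) ∈ wordSet φ A V (facts E V k) f.toWord := by
  have h0 := hs.start a ha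
  obtain ⟨f, t, ht, hx, hr⟩ := hs.exists_relWord hp 1 h0
  rw [one_mul] at hx
  refine ⟨f, t, ht, hx, hs.mem_foldl (v := (0, q, t)) ht ?_ ?_ hr⟩
  · intro u hu
    obtain ⟨⟨n, hn⟩, b, hb, hbu⟩ := mem_startSet.1 hu
    refine ⟨⟨n, hn⟩, fun w hw huw => mem_startSet.2 ⟨⟨_, hw⟩, b, hb, ?_⟩⟩
    exact hs.comp 1 (one_mem_labels φ) 1 (one_mem_labels φ) 1 (one_mem_labels φ) (mul_one 1)
      _ (hs.start b hb) _ hn w hw hbu huw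
  · exact mem_startSet.2 ⟨⟨0, h0⟩, a, ha, rel_of_mul h0 rfl (by simp)⟩

/-- Separation of the representatives and injectivity of `φ` make the decomposition `φ f * t`
unique, so the decomposition found by completeness is the given one. -/
theorem IsSaturated.path_iff (hs : IsSaturated φ C E A V (facts E V k) I)
    (hφ : Function.Injective φ) (hC : ∀ g, C g ↔ ∃ f, φ f = g)
    (hE : ∀ e ∈ E, e.1.unpair.1 = e.2.2.unpair.1) {a : ℕ} (ha : a ∈ A) {q : ℕ} {t : G}
    (ht : (0, q, t) ∈ V) (f : FreeGroup Bool) :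
    Path E (Nat.pair a 0) (φ f * t) (Nat.pair a 1) ↔
      (Nat.pair a 1, t) ∈ wordSet φ A V (facts E V k) f.toWord := by
  constructor
  · intro hp
    obtain ⟨f', t', ht', hx, hmem⟩ := hs.mem_wordSet_of_path ha hp
    have htt : t = t' := by
      rcases hs.separated _ ht _ ht' rfl rfl with h | ⟨x, -, hxt, hx'⟩
      · exact h
      · exfalso
        apply hx'
        rw [hC]
        refine ⟨f⁻¹ * f', ?_⟩
        have : x = t * t'⁻¹ := eq_mul_inv_of_mul_eq hxt
        rw [this, map_mul, map_inv, inv_mul_eq_iff_eq_mul, ← mul_assoc, hx]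
        group
    subst htt
    have : f = f' := hφ (mul_right_cancel hx)
    exact this ▸ hmem
  · intro h
    obtain ⟨b, hb, hp⟩ := path_of_mem_wordSet h
    rw [FreeGroup.mk_toWord] at hp
    -- Edges never leave their component, so a run that ends in the component of `a` started there.
    have hab := hp.mem_of_invariant (Y := fun p => {_x | p.unpair.1 = b})
      (fun e he _ hx => by rw [Set.mem_ofPred_eq, ← hE e he]; exact hx) (x := 1) (by simp)
    obtain rfl : a = b := by simpa using hab
    exact hp

section Exploration

variable (φ)

open Classical in
/-- Adds the successors of all pairs consisting of the last letter of a reduced word and the set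
of the vertices reached while producing it. -/
noncomputable def extendWords (V : List (ℕ × ℕ × G)) (S : List (ℕ × G × ℕ))
    (K : List (Option (Bool × Bool) × List (ℕ × G))) :
    List (Option (Bool × Bool) × List (ℕ × G)) :=
  K ++ K.flatMap fun s => (letters.filter fun x => s.1 ≠ some (x.1, !x.2)).map fun x =>
    (some x, nextSet φ V S s.2 x)

/-- The pairs of a last letter and a set of vertices that belong to short reduced words. -/
noncomputable def explored (A : List ℕ) (V : List (ℕ × ℕ × G)) (S : List (ℕ × G × ℕ)) (j : ℕ) :
    List (Option (Bool × Bool) × List (ℕ × G)) :=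
  (extendWords φ V S)^[j] [(none, startSet A V S)]

variable {φ} {S : List (ℕ × G × ℕ)}

theorem mem_extendWords {K : List (Option (Bool × Bool) × List (ℕ × G))}
    {s : Option (Bool × Bool) × List (ℕ × G)} : s ∈ extendWords φ V S K ↔
      s ∈ K ∨ ∃ s' ∈ K, ∃ x : Bool × Bool, s'.1 ≠ some (x.1, !x.2) ∧
        s = (some x, nextSet φ V S s'.2 x) := by
  simp only [extendWords, List.mem_append, List.mem_flatMap, List.mem_map, List.mem_filter,
    decide_eq_true_eq]
  constructor
  · rintro (h | ⟨s', hs', x, ⟨-, hx⟩, rfl⟩)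
    exacts [Or.inl h, Or.inr ⟨s', hs', x, hx, rfl⟩]
  · rintro (h | ⟨s', hs', x, hx, rfl⟩)
    exacts [Or.inl h, Or.inr ⟨s', hs', x, ⟨mem_letters x, hx⟩, rfl⟩]

theorem explored_succ (j : ℕ) :
    explored φ A V S (j + 1) = extendWords φ V S (explored φ A V S j) := by
  simp only [explored, Function.iterate_succ', Function.comp]

theorem explored_mono {i j : ℕ} (h : i ≤ j) {s : Option (Bool × Bool) × List (ℕ × G)}
    (hs : s ∈ explored φ A V S i) : s ∈ explored φ A V S j := by
  induction h with
  | refl => exact hs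
  | step _ ih => rw [explored_succ]; exact mem_extendWords.2 (Or.inl ih)

theorem isReduced_concat {l : List (Bool × Bool)} {x : Bool × Bool} :
    FreeGroup.IsReduced (l ++ [x]) ↔
      FreeGroup.IsReduced l ∧ l.getLast? ≠ some (x.1, !x.2) := by
  unfold FreeGroup.IsReduced
  rw [List.isChain_append]
  simp only [List.IsChain.singleton, true_and, List.head?_cons, Option.mem_def,
    Option.some.injEq, forall_eq']
  refine and_congr_right fun _ => ?_
  constructor
  · intro h h'
    have := h _ h' rfl
    simp at this
  · rintro h ⟨i, s⟩ hy rfl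
    by_contra hne
    apply h
    rw [hy]
    simpa using Bool.eq_not.2 hne

/-- Recording the last letter is what confines the exploration to reduced words; for other words the
reached set may be too small. -/
theorem exists_word_of_mem_explored {j : ℕ} {s : Option (Bool × Bool) × List (ℕ × G)}
    (hs : s ∈ explored φ A V S j) :
    ∃ l, FreeGroup.IsReduced l ∧ s = (l.getLast?, wordSet φ A V S l) := by
  induction j generalizing s with
  | zero =>
    refine ⟨[], by simp [FreeGroup.IsReduced], ?_⟩
    simpa [explored, wordSet] using hs
  | succ j ih =>
    rw [explored_succ, mem_extendWords] at hs
    rcases hs with hs | ⟨s', hs', x, hx, rfl⟩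
    · exact ih hs
    · obtain ⟨l, hl, rfl⟩ := ih hs'
      exact ⟨l ++ [x], isReduced_concat.2 ⟨hl, hx⟩, by simp [wordSet_concat]⟩

theorem mem_explored_of_closed {j : ℕ}
    (hj : ∀ s ∈ extendWords φ V S (explored φ A V S j), s ∈ explored φ A V S j)
    {l : List (Bool × Bool)} (hl : FreeGroup.IsReduced l) :
    (l.getLast?, wordSet φ A V S l) ∈ explored φ A V S j := by
  induction l using List.reverseRecOn with
  | nil => exact explored_mono (Nat.zero_le j) (by simp [explored, wordSet])
  | append_singleton l x ih =>
    obtain ⟨h1, h2⟩ := isReduced_concat.1 hl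
    refine hj _ (mem_extendWords.2 (Or.inr ⟨_, ih h1, x, h2, ?_⟩))
    simp [wordSet_concat]

end Exploration

open Classical in
/-- If the certificate is valid, a condition on the set of the `a ∈ A` whose automaton accepts an
element is satisfiable if and only if this is visible in the explored sets of vertices. -/
theorem IsSaturated.exists_iff (hs : IsSaturated φ C E A V (facts E V k) I)
    (hφ : Function.Injective φ) (hC : ∀ g, C g ↔ ∃ f, φ f = g)
    (hE : ∀ e ∈ E, e.1.unpair.1 = e.2.2.unpair.1)
    (hout : ∀ T : List G, ∃ x, ∀ t ∈ T, ∀ f, x ≠ φ f * t) {j : ℕ}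
    (hj : ∀ s ∈ extendWords φ V (facts E V k) (explored φ A V (facts E V k) j),
      s ∈ explored φ A V (facts E V k) j) (P : List ℕ → Prop) :
    (∃ x : G, P (A.filter fun a => Path E (Nat.pair a 0) x (Nat.pair a 1))) ↔
      P [] ∨ ∃ s ∈ explored φ A V (facts E V k) j, ∃ v ∈ V, v.1 = 0 ∧
        P (A.filter fun a => (Nat.pair a 1, v.2.2) ∈ s.2) := by
  have hin : ∀ (q : ℕ) (t : G), (0, q, t) ∈ V → ∀ f : FreeGroup Bool,
      (A.filter fun a => Path E (Nat.pair a 0) (φ f * t) (Nat.pair a 1)) =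
        A.filter fun a => (Nat.pair a 1, t) ∈ wordSet φ A V (facts E V k) f.toWord := by
    intro q t ht f
    refine List.filter_congr fun a ha => ?_
    simp only [hs.path_iff hφ hC hE ha ht f]
  have hnil : ∀ x : G, (∀ q t, (0, q, t) ∈ V → ∀ f, x ≠ φ f * t) →
      (A.filter fun a => Path E (Nat.pair a 0) x (Nat.pair a 1)) = [] := by
    intro x hx
    rw [List.filter_eq_nil_iff]
    intro a ha hp
    obtain ⟨f, t, ht, hxt, -⟩ := hs.mem_wordSet_of_path ha (by simpa using hp)
    exact hx _ t ht f hxt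
  constructor
  · rintro ⟨x, hx⟩
    by_cases h : ∃ q t, (0, q, t) ∈ V ∧ ∃ f, x = φ f * t
    · obtain ⟨q, t, ht, f, rfl⟩ := h
      right
      refine ⟨_, mem_explored_of_closed hj (FreeGroup.isReduced_toWord (x := f)), _, ht, rfl, ?_⟩
      rwa [hin q t ht f] at hx
    · left
      rwa [hnil x fun q t ht f hf => h ⟨q, t, ht, f, hf⟩] at hx
  · rintro (h | ⟨s, hsj, ⟨_, q, t⟩, hv, rfl, h⟩)
    -- An element outside the cosets of all vertices is rejected by every automaton and realizes the
    -- empty set.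
    · obtain ⟨x, hx⟩ := hout (V.map fun v => v.2.2)
      refine ⟨x, ?_⟩
      rwa [hnil x fun q t ht f => hx t (List.mem_map.2 ⟨_, ht, rfl⟩) f]
    · obtain ⟨l, hl, rfl⟩ := exists_word_of_mem_explored hsj
      refine ⟨φ (FreeGroup.mk l) * t, ?_⟩
      rw [hin q t hv, FreeGroup.toWord_mk, hl.reduce_eq]
      exact h

end Automata

/-! ### Existence of valid certificates. -/

section Existence

variable {G : Type*} [Group G]

theorem exists_uniform_index {β : Type*} {F : ℕ → List β}
    (hF : ∀ i j, i ≤ j → ∀ s ∈ F i, s ∈ F j) {Q : Set β} (hQ : Q.Finite)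
    (h : ∀ s ∈ Q, ∃ k, s ∈ F k) : ∃ k, ∀ s ∈ Q, s ∈ F k := by
  induction Q, hQ using Set.Finite.induction_on with
  | empty => exact ⟨0, by simp⟩
  | @insert a Q _ _ ih =>
    obtain ⟨k, hk⟩ := ih fun s hs => h s (Set.mem_insert_of_mem _ hs)
    obtain ⟨l, hl⟩ := h a (Set.mem_insert _ _)
    refine ⟨max k l, fun s hs => ?_⟩
    rcases Set.mem_insert_iff.1 hs with rfl | hs
    · exact hF _ _ (le_max_right _ _) _ hl
    · exact hF _ _ (le_max_left _ _) _ (hk s hs)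

theorem Path.target {E : List (ℕ × G × ℕ)} {p q : ℕ} {g : G} (h : Path E p g q) :
    q = p ∨ ∃ e ∈ E, e.2.2 = q := by
  induction h with
  | nil p => exact Or.inl rfl
  | cons he _ ih =>
    rcases ih with rfl | ih
    · exact Or.inr ⟨_, he, rfl⟩
    · exact Or.inr ih

variable {φ : FreeGroup Bool →* G} {C : G → Prop} {E : List (ℕ × G × ℕ)} {A : List ℕ}

/-- Only finitely many triples of two vertices and an element of `O` have to be realized, and each
true relation among them is derived after finitely many rounds. -/
theorem exists_facts_complete (E : List (ℕ × G × ℕ)) (V : List (ℕ × ℕ × G)) (O : List G) :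
    ∃ k, ∀ u ∈ V, ∀ o ∈ O, ∀ v ∈ V, Path E u.2.1 (u.2.2⁻¹ * o * v.2.2) v.2.1 →
      Rel (facts E V k) u.2 o v.2 := by
  classical
  let Q : Set (ℕ × G × ℕ) := {s | (∃ u ∈ V, ∃ o ∈ O, ∃ v ∈ V,
    (u.2.1, u.2.2⁻¹ * o * v.2.2, v.2.1) = s) ∧ Path E s.1 s.2.1 s.2.2}
  have hQ : Q.Finite := by
    refine Set.Finite.subset (List.finite_toSet
      (V.flatMap fun u => O.flatMap fun o => V.map fun v =>
        (u.2.1, u.2.2⁻¹ * o * v.2.2, v.2.1))) ?_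
    rintro s ⟨⟨u, hu, o, ho, v, hv, rfl⟩, -⟩
    exact List.mem_flatMap.2 ⟨u, hu, List.mem_flatMap.2 ⟨o, ho, List.mem_map.2 ⟨v, hv, rfl⟩⟩⟩
  obtain ⟨k, hk⟩ := exists_uniform_index (F := facts E V) (fun i j h s => facts_mono E V h) hQ
    (by
      rintro _ ⟨⟨u, hu, o, ho, v, hv, rfl⟩, hp⟩
      exact exists_mem_facts hp ⟨v, hv, rfl⟩)
  refine ⟨k, fun u hu o ho v hv hp => ⟨_, hk _ ⟨⟨u, hu, o, ho, v, hv, rfl⟩, hp⟩, rfl, rfl, ?_⟩⟩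
  simp [mul_assoc]

theorem wordSet_sublist (A : List ℕ) (V : List (ℕ × ℕ × G)) (S : List (ℕ × G × ℕ))
    (l : List (Bool × Bool)) : (wordSet φ A V S l).Sublist (V.map Prod.snd) := by
  classical
  induction l using List.reverseRecOn with
  | nil => exact List.filter_sublist
  | append_singleton l x _ => rw [wordSet_concat]; exact List.filter_sublist

/-- Reached sets are sublists of one fixed list, so only finitely many pairs can ever be explored.
-/
theorem exists_explored_closed (A : List ℕ) (V : List (ℕ × ℕ × G)) (S : List (ℕ × G × ℕ)) :
    ∃ j, ∀ s ∈ extendWords φ V S (explored φ A V S j), s ∈ explored φ A V S j := by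
  classical
  let Q : Set (Option (Bool × Bool) × List (ℕ × G)) := {s | ∃ j, s ∈ explored φ A V S j}
  have hQ : Q.Finite := by
    refine Set.Finite.subset (Set.finite_univ.prod
      (List.finite_toSet (V.map Prod.snd).sublists)) ?_
    rintro s ⟨j, hs⟩
    obtain ⟨l, -, rfl⟩ := exists_word_of_mem_explored hs
    exact ⟨Set.mem_univ _, List.mem_sublists.2 (wordSet_sublist A V S l)⟩
  obtain ⟨j, hj⟩ := exists_uniform_index (F := explored φ A V S)
    (fun i j h s => explored_mono h) hQ fun s hs => hs
  exact ⟨j, fun s hs => hj s ⟨j + 1, by rwa [explored_succ]⟩⟩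

/-- Vertices of rank zero are the reachable pairs of a state and a representative. The others attach
a word to such a pair, long enough to spell the contribution of any single edge. -/
theorem exists_vertices (φ : FreeGroup Bool →* G) (E : List (ℕ × G × ℕ)) {A : List ℕ}
    {T : Set G} (hT : T.Finite) (h1 : (1 : G) ∈ T)
    (hcover : ∀ a ∈ A, ∀ x q, Path E (Nat.pair a 0) x q → ∃ t ∈ T, ∃ f, x = φ f * t) :
    ∃ V : List (ℕ × ℕ × G),
      (∀ v ∈ V, v.1 = 0 → v.2.2 ∈ T) ∧ (∀ a ∈ A, (0, Nat.pair a 0, 1) ∈ V) ∧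
      (∀ v ∈ V, v.1 = 0 ∨ ∃ v' ∈ V, ∃ x ∈ letters,
        v'.1 + 1 = v.1 ∧ v'.2.1 = v.2.1 ∧ v.2.2 = letterVal φ x * v'.2.2) ∧
      ∀ v ∈ V, v.1 = 0 → ∀ e ∈ E, e.1 = v.2.1 →
        ∃ v' ∈ V, v'.2.1 = e.2.2 ∧ v'.2.2 = v.2.2 * e.2.1 := by
  classical
  let R : Set (ℕ × G) := {s | s.2 ∈ T ∧ ∃ a ∈ A, ∃ x f, Path E (Nat.pair a 0) x s.1 ∧ x = φ f * s.2}
  have hR : R.Finite := by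
    refine Set.Finite.subset ((List.finite_toSet
      (A.map (fun a => Nat.pair a 0) ++ E.map fun e => e.2.2)).prod hT) ?_
    rintro ⟨q, t⟩ ⟨ht, a, ha, x, f, hp, -⟩
    refine ⟨?_, ht⟩
    rcases hp.target with h | ⟨e, he, h⟩
    · exact List.mem_append_left _ (List.mem_map.2 ⟨a, ha, h.symm⟩)
    · exact List.mem_append_right _ (List.mem_map.2 ⟨e, he, h⟩)
  have hstep : ∀ s ∈ R, ∀ e ∈ E, e.1 = s.1 → ∃ w : List (Bool × Bool), ∃ t',
      (e.2.2, t') ∈ R ∧ s.2 * e.2.1 = φ (FreeGroup.mk w) * t' := by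
    rintro ⟨p, t⟩ ⟨ht, a, ha, x, f, hp, rfl⟩ ⟨p', g, q⟩ he rfl
    have hp' := hp.trans (Path.single he)
    obtain ⟨t', ht', f', hx⟩ := hcover a ha _ _ hp'
    refine ⟨(f⁻¹ * f').toWord, t', ⟨ht', a, ha, _, f', hp', hx⟩, ?_⟩
    rw [FreeGroup.mk_toWord, map_mul, map_inv, mul_assoc, ← hx]
    group
  choose! w t' hw using hstep
  -- `N` bounds the lengths of the words contributed by the finitely many edges; taking all words up
  -- to this length makes the vertex set closed under dropping the first letter.
  obtain ⟨N, hN⟩ := ((hR.prod (List.finite_toSet E)).image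
    fun z => (w z.1 z.2).length).bddAbove
  let F : (ℕ × G) × List (Bool × Bool) → ℕ × ℕ × G := fun z =>
    (z.2.length, z.1.1, φ (FreeGroup.mk z.2) * z.1.2)
  have hV := ((hR.prod (List.finite_length_le (Bool × Bool) N)).image F)
  refine ⟨hV.toFinset.toList, ?_⟩
  simp only [Finset.mem_toList, Set.Finite.mem_toFinset]
  have hzero : ∀ s ∈ R, (0, s) ∈ F '' (R ×ˢ {l : List (Bool × Bool) | l.length ≤ N}) := by
    intro s hs
    refine ⟨(s, []), ⟨hs, by simp⟩, ?_⟩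
    simp [F, ← FreeGroup.one_eq_mk]
  have hrank : ∀ v ∈ F '' (R ×ˢ {l : List (Bool × Bool) | l.length ≤ N}), v.1 = 0 →
      v.2 ∈ R := by
    rintro _ ⟨⟨s, l⟩, ⟨hs, -⟩, rfl⟩ h0
    obtain rfl : l = [] := List.length_eq_zero_iff.1 h0
    simpa [F, ← FreeGroup.one_eq_mk] using hs
  refine ⟨fun v hv h0 => (hrank v hv h0).1, ?_, ?_, ?_⟩
  · exact fun a ha => hzero (Nat.pair a 0, 1) ⟨h1, a, ha, 1, 1, Path.nil _, by simp⟩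
  · rintro _ ⟨⟨s, l⟩, ⟨hs, hl⟩, rfl⟩
    rcases l with _ | ⟨x, l⟩
    · exact Or.inl rfl
    · refine Or.inr ⟨F (s, l), ⟨(s, l), ⟨hs, ?_⟩, rfl⟩, x, mem_letters x, rfl, rfl, ?_⟩
      · simp at hl ⊢; omega
      · simp [F, map_mk_cons φ x l, mul_assoc]
  · intro v hv h0 e he hev
    have hvR := hrank v hv h0
    obtain ⟨h2, h3⟩ := hw v.2 hvR e he hev
    refine ⟨F ((e.2.2, t' v.2 e), w v.2 e), ⟨_, ⟨h2, ?_⟩, rfl⟩, rfl, h3.symm⟩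
    exact hN ⟨(v.2, e), ⟨hvR, he⟩, rfl⟩

theorem exists_isSaturated (hC : ∀ g, C g ↔ ∃ f, φ f = g) {T : Set G} (hT : T.Finite)
    (h1 : (1 : G) ∈ T) (hsep : ∀ t ∈ T, ∀ t' ∈ T, ∀ f, t = φ f * t' → t = t')
    (hcover : ∀ a ∈ A, ∀ x q, Path E (Nat.pair a 0) x q → ∃ t ∈ T, ∃ f, x = φ f * t) :
    ∃ V k I, IsSaturated φ C E A V (facts E V k) I := by
  obtain ⟨V, hVT, hstart, hdesc, hclosed⟩ := exists_vertices φ E hT h1 hcover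
  obtain ⟨k, hk⟩ := exists_facts_complete E V (labels φ)
  -- The last component lists the quotients of representatives. As they are part of the certificate,
  -- checking separation needs multiplication but no inverses.
  refine ⟨V, k, V.flatMap fun v => V.map fun v' => v.2.2 * v'.2.2⁻¹, ?_, hdesc, hclosed, hstart, ?_⟩
  -- Composed relations come from composed paths, and `k` was chosen so that every true relation
  -- with a short label is already derived.
  · intro o₁ _ o₂ _ o₃ ho₃ ho u hu v _ w hw huv hvw
    refine hk u hu o₃ ho₃ w hw ?_
    convert (path_of_rel huv).trans (path_of_rel hvw) using 1
    rw [← ho]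
    group
  · intro v hv v' hv' h0 h0'
    by_cases h : v.2.2 = v'.2.2
    · exact Or.inl h
    · refine Or.inr ⟨v.2.2 * v'.2.2⁻¹,
        List.mem_flatMap.2 ⟨v, hv, List.mem_map.2 ⟨v', hv', rfl⟩⟩, by simp, fun hc => h ?_⟩
      obtain ⟨f, hf⟩ := (hC _).1 hc
      exact hsep _ (hVT v hv h0) _ (hVT v' hv' h0') f (by rw [hf]; simp)

end Existence

/-! ### Primitive recursive verification of certificates, and the search. -/

section Checking

variable {G : Type*} [Group G] [Primcodable G] {α : Type*} [Primcodable α]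

theorem primrec_compose (hmul : Primrec₂ ((· * ·) : G → G → G)) :
    Primrec (compose : List (ℕ × G × ℕ) → List (ℕ × G × ℕ)) := by
  classical
  refine Primrec.list_append.comp Primrec.id (Primrec.list_flatMap Primrec.id ?_)
  refine Primrec.list_map (f := fun z : List (ℕ × G × ℕ) × (ℕ × G × ℕ) =>
    z.1.filter fun y => y.1 = z.2.2.2) (g := fun z y => (z.2.1, z.2.2.1 * y.2.1, y.2.2)) ?_ ?_
  · refine primrec_list_filter Primrec.fst (Primrec.eq.comp (Primrec.fst.comp Primrec.snd) ?_)
    exact Primrec.snd.comp (Primrec.snd.comp (Primrec.snd.comp Primrec.fst))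
  · refine (Primrec.fst.comp (Primrec.snd.comp Primrec.fst)).pair
      (Primrec.pair (hmul.comp ?_ ?_) ?_)
    · exact Primrec.fst.comp (Primrec.snd.comp (Primrec.snd.comp Primrec.fst))
    · exact Primrec.fst.comp (Primrec.snd.comp Primrec.snd)
    · exact Primrec.snd.comp (Primrec.snd.comp Primrec.snd)

theorem primrec_facts (hmul : Primrec₂ ((· * ·) : G → G → G)) {E : α → List (ℕ × G × ℕ)}
    {V : α → List (ℕ × ℕ × G)} {k : α → ℕ} (hE : Primrec E) (hV : Primrec V) (hk : Primrec k) :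
    Primrec fun a => facts (E a) (V a) (k a) := by
  refine Primrec.nat_iterate hk (Primrec.list_append.comp hE (Primrec.list_map hV ?_))
    ((primrec_compose hmul).comp Primrec.snd)
  have h : Primrec fun z : α × ℕ × ℕ × G => z.2.2.1 :=
    Primrec.fst.comp (Primrec.snd.comp Primrec.snd)
  exact h.pair ((Primrec.const 1).pair h)

theorem primrecPred_rel (hmul : Primrec₂ ((· * ·) : G → G → G)) {S : α → List (ℕ × G × ℕ)}
    {u v : α → ℕ × G} {o : α → G} (hS : Primrec S) (hu : Primrec u) (ho : Primrec o)
    (hv : Primrec v) : PrimrecPred fun a => Rel (S a) (u a) (o a) (v a) := by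
  have hs : Primrec fun z : α × ℕ × G × ℕ => z.2 := Primrec.snd
  have hu' := hu.comp (Primrec.fst (α := α) (β := ℕ × G × ℕ))
  have hv' := hv.comp (Primrec.fst (α := α) (β := ℕ × G × ℕ))
  have ho' := ho.comp (Primrec.fst (α := α) (β := ℕ × G × ℕ))
  refine primrecPred_exists_mem hS (PrimrecPred.and
    (Primrec.eq.comp (Primrec.fst.comp hs) (Primrec.fst.comp hu')) (PrimrecPred.and
    (Primrec.eq.comp (Primrec.snd.comp (Primrec.snd.comp hs)) (Primrec.fst.comp hv'))
    (Primrec.eq.comp (hmul.comp (Primrec.snd.comp hu') (Primrec.fst.comp (Primrec.snd.comp hs)))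
      (hmul.comp ho' (Primrec.snd.comp hv')))))

variable {φ : FreeGroup Bool →* G} {C : G → Prop}

theorem primrecPred_comp (hmul : Primrec₂ ((· * ·) : G → G → G)) {V : α → List (ℕ × ℕ × G)}
    {S : α → List (ℕ × G × ℕ)} (hV : Primrec V) (hS : Primrec S) :
    PrimrecPred fun a => ∀ o₁ ∈ labels φ, ∀ o₂ ∈ labels φ, ∀ o₃ ∈ labels φ, o₁ * o₂ = o₃ →
      ∀ u ∈ V a, ∀ v ∈ V a, ∀ w ∈ V a,
        Rel (S a) u.2 o₁ v.2 → Rel (S a) v.2 o₂ w.2 → Rel (S a) u.2 o₃ w.2 := by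
  refine primrecPred_forall_mem (Primrec.const _) ?_
  refine primrecPred_forall_mem (α := α × G) (Primrec.const _) ?_
  refine primrecPred_forall_mem (α := (α × G) × G) (Primrec.const _) ?_
  refine primrecPred_imp (α := ((α × G) × G) × G) (Primrec.eq.comp (hmul.comp
    (Primrec.snd.comp (Primrec.fst.comp Primrec.fst)) (Primrec.snd.comp Primrec.fst))
    Primrec.snd) ?_
  have h1 : Primrec fun z : ((α × G) × G) × G => z.1.1.1 :=
    Primrec.fst.comp (Primrec.fst.comp Primrec.fst)
  refine primrecPred_forall_mem (hV.comp h1) ?_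
  refine primrecPred_forall_mem (α := (((α × G) × G) × G) × ℕ × ℕ × G)
    (hV.comp (h1.comp Primrec.fst)) ?_
  refine primrecPred_forall_mem (α := ((((α × G) × G) × G) × ℕ × ℕ × G) × ℕ × ℕ × G)
    (hV.comp (h1.comp (Primrec.fst.comp Primrec.fst))) ?_
  let X := (((((α × G) × G) × G) × ℕ × ℕ × G) × ℕ × ℕ × G) × ℕ × ℕ × G
  have hc : Primrec fun z : X => z.1.1.1 := Primrec.fst.comp (Primrec.fst.comp Primrec.fst)
  have hS' : Primrec fun z : X => S z.1.1.1.1.1.1 := hS.comp (h1.comp hc)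
  have hu : Primrec fun z : X => z.1.1.2.2 :=
    Primrec.snd.comp (Primrec.snd.comp (Primrec.fst.comp Primrec.fst))
  have hv : Primrec fun z : X => z.1.2.2 :=
    Primrec.snd.comp (Primrec.snd.comp Primrec.fst)
  have hw : Primrec fun z : X => z.2.2 := Primrec.snd.comp Primrec.snd
  have ho1 : Primrec fun z : X => z.1.1.1.1.1.2 :=
    Primrec.snd.comp (Primrec.fst.comp (Primrec.fst.comp hc))
  have ho2 : Primrec fun z : X => z.1.1.1.1.2 := Primrec.snd.comp (Primrec.fst.comp hc)
  have ho3 : Primrec fun z : X => z.1.1.1.2 := Primrec.snd.comp hc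
  exact primrecPred_imp (primrecPred_rel hmul hS' hu ho1 hv)
    (primrecPred_imp (primrecPred_rel hmul hS' hv ho2 hw) (primrecPred_rel hmul hS' hu ho3 hw))

theorem primrecPred_descend (hmul : Primrec₂ ((· * ·) : G → G → G))
    {V : α → List (ℕ × ℕ × G)} (hV : Primrec V) :
    PrimrecPred fun a => ∀ v ∈ V a, v.1 = 0 ∨ ∃ v' ∈ V a, ∃ x ∈ letters,
      v'.1 + 1 = v.1 ∧ v'.2.1 = v.2.1 ∧ v.2.2 = letterVal φ x * v'.2.2 := by
  refine primrecPred_forall_mem hV (PrimrecPred.or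
    (Primrec.eq.comp (Primrec.fst.comp Primrec.snd) (Primrec.const 0)) ?_)
  refine primrecPred_exists_mem (hV.comp Primrec.fst) ?_
  refine primrecPred_exists_mem (α := (α × ℕ × ℕ × G) × ℕ × ℕ × G) (Primrec.const _) ?_
  let X := ((α × ℕ × ℕ × G) × ℕ × ℕ × G) × Bool × Bool
  have hv : Primrec fun z : X => z.1.1.2 := Primrec.snd.comp (Primrec.fst.comp Primrec.fst)
  have hv' : Primrec fun z : X => z.1.2 := Primrec.snd.comp Primrec.fst
  -- There are only four letters, so no computability of `φ` itself has to be assumed.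
  have hx : Primrec fun z : X => letterVal φ z.2 :=
    (Primrec.dom_finite (letterVal φ)).comp Primrec.snd
  exact PrimrecPred.and (Primrec.eq.comp (Primrec.succ.comp (Primrec.fst.comp hv'))
    (Primrec.fst.comp hv)) (PrimrecPred.and (Primrec.eq.comp
      (Primrec.fst.comp (Primrec.snd.comp hv')) (Primrec.fst.comp (Primrec.snd.comp hv)))
      (Primrec.eq.comp (Primrec.snd.comp (Primrec.snd.comp hv))
        (hmul.comp hx (Primrec.snd.comp (Primrec.snd.comp hv')))))

theorem primrecPred_closed (hmul : Primrec₂ ((· * ·) : G → G → G)) {E : α → List (ℕ × G × ℕ)}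
    {V : α → List (ℕ × ℕ × G)} (hE : Primrec E) (hV : Primrec V) :
    PrimrecPred fun a => ∀ v ∈ V a, v.1 = 0 → ∀ e ∈ E a, e.1 = v.2.1 →
      ∃ v' ∈ V a, v'.2.1 = e.2.2 ∧ v'.2.2 = v.2.2 * e.2.1 := by
  refine primrecPred_forall_mem hV (primrecPred_imp
    (Primrec.eq.comp (Primrec.fst.comp Primrec.snd) (Primrec.const 0)) ?_)
  refine primrecPred_forall_mem (α := α × ℕ × ℕ × G) (hE.comp Primrec.fst) ?_
  refine primrecPred_imp (α := (α × ℕ × ℕ × G) × ℕ × G × ℕ) (Primrec.eq.comp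
    (Primrec.fst.comp Primrec.snd)
    (Primrec.fst.comp (Primrec.snd.comp (Primrec.snd.comp Primrec.fst)))) ?_
  refine primrecPred_exists_mem (hV.comp (Primrec.fst.comp Primrec.fst)) ?_
  let X := ((α × ℕ × ℕ × G) × ℕ × G × ℕ) × ℕ × ℕ × G
  have hv : Primrec fun z : X => z.1.1.2.2 :=
    Primrec.snd.comp (Primrec.snd.comp (Primrec.fst.comp Primrec.fst))
  have he : Primrec fun z : X => z.1.2.2 := Primrec.snd.comp (Primrec.snd.comp Primrec.fst)
  have hv' : Primrec fun z : X => z.2.2 := Primrec.snd.comp Primrec.snd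
  exact PrimrecPred.and (Primrec.eq.comp (Primrec.fst.comp hv') (Primrec.snd.comp he))
    (Primrec.eq.comp (Primrec.snd.comp hv')
      (hmul.comp (Primrec.snd.comp hv) (Primrec.fst.comp he)))

theorem primrecPred_separated (hmul : Primrec₂ ((· * ·) : G → G → G)) (hC : PrimrecPred C)
    {V : α → List (ℕ × ℕ × G)} {I : α → List G} (hV : Primrec V) (hI : Primrec I) :
    PrimrecPred fun a => ∀ v ∈ V a, ∀ v' ∈ V a, v.1 = 0 → v'.1 = 0 →
      v.2.2 = v'.2.2 ∨ ∃ x ∈ I a, x * v'.2.2 = v.2.2 ∧ ¬ C x := by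
  refine primrecPred_forall_mem hV ?_
  refine primrecPred_forall_mem (α := α × ℕ × ℕ × G) (hV.comp Primrec.fst) ?_
  let X := (α × ℕ × ℕ × G) × ℕ × ℕ × G
  have hv : Primrec fun z : X => z.1.2 := Primrec.snd.comp Primrec.fst
  have hv' : Primrec fun z : X => z.2 := Primrec.snd
  have hy := Primrec.snd.comp (Primrec.snd.comp hv)
  have hy' := Primrec.snd.comp (Primrec.snd.comp hv')
  refine primrecPred_imp (Primrec.eq.comp (Primrec.fst.comp hv) (Primrec.const 0))
    (primrecPred_imp (Primrec.eq.comp (Primrec.fst.comp hv') (Primrec.const 0))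
      (PrimrecPred.or (Primrec.eq.comp hy hy') ?_))
  refine primrecPred_exists_mem (hI.comp (Primrec.fst.comp Primrec.fst)) ?_
  exact PrimrecPred.and (Primrec.eq.comp (hmul.comp Primrec.snd (hy'.comp Primrec.fst))
    (hy.comp Primrec.fst)) (hC.comp Primrec.snd).not

theorem primrecPred_isSaturated (hmul : Primrec₂ ((· * ·) : G → G → G)) (hC : PrimrecPred C)
    {E S : α → List (ℕ × G × ℕ)} {A : α → List ℕ} {V : α → List (ℕ × ℕ × G)} {I : α → List G}
    (hE : Primrec E) (hA : Primrec A) (hV : Primrec V) (hS : Primrec S) (hI : Primrec I) :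
    PrimrecPred fun a => IsSaturated φ C (E a) (A a) (V a) (S a) (I a) := by
  have hstart : PrimrecPred fun a => ∀ b ∈ A a, (0, Nat.pair b 0, 1) ∈ V a := by
    refine primrecPred_forall_mem hA (primrecPred_mem (hV.comp Primrec.fst) ?_)
    exact (Primrec.const 0).pair ((Primrec₂.natPair.comp Primrec.snd (Primrec.const 0)).pair
      (Primrec.const 1))
  refine ((primrecPred_comp (φ := φ) hmul hV hS).and ((primrecPred_descend (φ := φ) hmul hV).and
    ((primrecPred_closed hmul hE hV).and (hstart.and
      (primrecPred_separated hmul hC hV hI))))).of_eq fun a => ?_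
  exact ⟨fun ⟨h1, h2, h3, h4, h5⟩ => ⟨h1, h2, h3, h4, h5⟩,
    fun ⟨h1, h2, h3, h4, h5⟩ => ⟨h1, h2, h3, h4, h5⟩⟩

theorem primrec_nextSet (hmul : Primrec₂ ((· * ·) : G → G → G)) {V : α → List (ℕ × ℕ × G)}
    {S : α → List (ℕ × G × ℕ)} {D : α → List (ℕ × G)} {x : α → Bool × Bool} (hV : Primrec V)
    (hS : Primrec S) (hD : Primrec D) (hx : Primrec x) :
    Primrec fun a => nextSet φ (V a) (S a) (D a) (x a) := by
  classical
  refine primrec_list_filter (Primrec.list_map hV (Primrec.snd.comp Primrec.snd)) ?_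
  refine primrecPred_exists_mem (α := α × ℕ × G) (hD.comp Primrec.fst) ?_
  exact primrecPred_rel hmul (hS.comp (Primrec.fst.comp Primrec.fst)) Primrec.snd
    ((Primrec.dom_finite (letterVal φ)).comp (hx.comp (Primrec.fst.comp Primrec.fst)))
    (Primrec.snd.comp Primrec.fst)

theorem primrec_startSet (hmul : Primrec₂ ((· * ·) : G → G → G)) {A : α → List ℕ}
    {V : α → List (ℕ × ℕ × G)} {S : α → List (ℕ × G × ℕ)} (hA : Primrec A) (hV : Primrec V)
    (hS : Primrec S) : Primrec fun a => startSet (A a) (V a) (S a) := by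
  classical
  refine primrec_list_filter (Primrec.list_map hV (Primrec.snd.comp Primrec.snd)) ?_
  refine primrecPred_exists_mem (α := α × ℕ × G) (hA.comp Primrec.fst) ?_
  exact primrecPred_rel hmul (hS.comp (Primrec.fst.comp Primrec.fst))
    ((Primrec₂.natPair.comp Primrec.snd (Primrec.const 0)).pair (Primrec.const 1))
    (Primrec.const 1) (Primrec.snd.comp Primrec.fst)

theorem primrec_extendWords (hmul : Primrec₂ ((· * ·) : G → G → G)) {V : α → List (ℕ × ℕ × G)}
    {S : α → List (ℕ × G × ℕ)} {K : α → List (Option (Bool × Bool) × List (ℕ × G))}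
    (hV : Primrec V) (hS : Primrec S) (hK : Primrec K) :
    Primrec fun a => extendWords φ (V a) (S a) (K a) := by
  classical
  refine Primrec.list_append.comp hK (Primrec.list_flatMap hK ?_)
  refine Primrec.list_map (f := fun z : α × Option (Bool × Bool) × List (ℕ × G) =>
    letters.filter fun x => z.2.1 ≠ some (x.1, !x.2))
    (g := fun z x => (some x, nextSet φ (V z.1) (S z.1) z.2.2 x)) ?_ ?_
  · refine primrec_list_filter (Primrec.const _) (Primrec.eq.comp
      (Primrec.fst.comp (Primrec.snd.comp Primrec.fst)) ?_).not
    exact (Primrec.dom_finite fun x : Bool × Bool => some (x.1, !x.2)).comp Primrec.snd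
  · exact (Primrec.option_some.comp Primrec.snd).pair (primrec_nextSet hmul
      (hV.comp (Primrec.fst.comp Primrec.fst)) (hS.comp (Primrec.fst.comp Primrec.fst))
      (Primrec.snd.comp (Primrec.snd.comp Primrec.fst)) Primrec.snd)

theorem primrec_explored (hmul : Primrec₂ ((· * ·) : G → G → G)) {A : α → List ℕ}
    {V : α → List (ℕ × ℕ × G)} {S : α → List (ℕ × G × ℕ)} {j : α → ℕ} (hA : Primrec A)
    (hV : Primrec V) (hS : Primrec S) (hj : Primrec j) :
    Primrec fun a => explored φ (A a) (V a) (S a) (j a) := by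
  refine Primrec.nat_iterate hj (Primrec.list_cons.comp
    ((Primrec.const none).pair (primrec_startSet hmul hA hV hS)) (Primrec.const []))
    (primrec_extendWords hmul (hV.comp Primrec.fst) (hS.comp Primrec.fst) Primrec.snd)

open Classical in
/-- Satisfiability of a primitive recursive condition on the set of accepting automata is
decidable, provided that the elements read by the automata lie in finitely many right cosets of
the image of the free group. -/
theorem exists_computable_satisfiable (hmul : Primrec₂ ((· * ·) : G → G → G))
    (hC : PrimrecPred C) (hφ : Function.Injective φ) (hCφ : ∀ g, C g ↔ ∃ f, φ f = g)
    (hout : ∀ T : List G, ∃ x, ∀ t ∈ T, ∀ f, x ≠ φ f * t)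
    {E : ℕ → List (ℕ × G × ℕ)} {A : ℕ → List ℕ} {P : List ℕ → ℕ → Prop} (hE : Primrec E)
    (hA : Primrec A) (hP : PrimrecRel P)
    (hcomp : ∀ n, ∀ e ∈ E n, e.1.unpair.1 = e.2.2.unpair.1)
    (hfin : ∀ n, ∃ T : Set G, T.Finite ∧ (1 : G) ∈ T ∧
      (∀ t ∈ T, ∀ t' ∈ T, ∀ f, t = φ f * t' → t = t') ∧
      ∀ a ∈ A n, ∀ x q, Path (E n) (Nat.pair a 0) x q → ∃ t ∈ T, ∃ f, x = φ f * t) :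
    ∃ f : ℕ → Bool, Computable f ∧ ∀ n, f n = true ↔
      ∃ x : G, P ((A n).filter fun a => Path (E n) (Nat.pair a 0) x (Nat.pair a 1)) n := by
  -- The components are the vertices, the number of saturation rounds, the separating quotients and
  -- the number of exploration rounds.
  let Cert := List (ℕ × ℕ × G) × ℕ × List G × ℕ
  let S : ℕ × Cert → List (ℕ × G × ℕ) := fun z => facts (E z.1) z.2.1 z.2.2.1
  let K : ℕ × Cert → List (Option (Bool × Bool) × List (ℕ × G)) := fun z =>
    explored φ (A z.1) z.2.1 (S z) z.2.2.2.2
  let Valid : ℕ × Cert → Prop := fun z =>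
    IsSaturated φ C (E z.1) (A z.1) z.2.1 (S z) z.2.2.2.1 ∧
      ∀ s ∈ extendWords φ z.2.1 (S z) (K z), s ∈ K z
  let Answer : ℕ × Cert → Prop := fun z => P [] z.1 ∨ ∃ s ∈ K z, ∃ v ∈ z.2.1, v.1 = 0 ∧
    P ((A z.1).filter fun a => (Nat.pair a 1, v.2.2) ∈ s.2) z.1
  have hn : Primrec fun z : ℕ × Cert => z.1 := Primrec.fst
  have hV : Primrec fun z : ℕ × Cert => z.2.1 := Primrec.fst.comp Primrec.snd
  have hk : Primrec fun z : ℕ × Cert => z.2.2.1 :=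
    Primrec.fst.comp (Primrec.snd.comp Primrec.snd)
  have hI : Primrec fun z : ℕ × Cert => z.2.2.2.1 :=
    Primrec.fst.comp (Primrec.snd.comp (Primrec.snd.comp Primrec.snd))
  have hj : Primrec fun z : ℕ × Cert => z.2.2.2.2 :=
    Primrec.snd.comp (Primrec.snd.comp (Primrec.snd.comp Primrec.snd))
  have hS : Primrec S := primrec_facts hmul (hE.comp hn) hV hk
  have hK : Primrec K := primrec_explored hmul (hA.comp hn) hV hS hj
  have hValid : PrimrecPred Valid :=
    (primrecPred_isSaturated hmul hC (hE.comp hn) (hA.comp hn) hV hS hI).and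
      (primrecPred_forall_mem (primrec_extendWords hmul hV hS hK)
        (primrecPred_mem (hK.comp Primrec.fst) Primrec.snd))
  have hAnswer : PrimrecPred Answer := by
    refine PrimrecPred.or (hP.comp (Primrec.const []) hn) (primrecPred_exists_mem hK ?_)
    refine primrecPred_exists_mem (hV.comp Primrec.fst) (PrimrecPred.and
      (Primrec.eq.comp (Primrec.fst.comp Primrec.snd) (Primrec.const 0))
      (hP.comp ?_ (hn.comp (Primrec.fst.comp Primrec.fst))))
    refine primrec_list_filter (hA.comp (hn.comp (Primrec.fst.comp Primrec.fst)))
      (primrecPred_mem ?_ ?_)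
    · exact Primrec.snd.comp (Primrec.snd.comp (Primrec.fst.comp Primrec.fst))
    · exact (Primrec₂.natPair.comp Primrec.snd (Primrec.const 1)).pair
        (Primrec.snd.comp (Primrec.snd.comp (Primrec.snd.comp Primrec.fst)))
  have hex : ∀ n, ∃ c, Valid (n, c) := by
    intro n
    obtain ⟨T, hT, h1, hsep, hcover⟩ := hfin n
    obtain ⟨V, k, I, hs⟩ := exists_isSaturated (C := C) hCφ hT h1 hsep hcover
    obtain ⟨j, hj⟩ := exists_explored_closed (φ := φ) (A n) V (facts (E n) V k)
    exact ⟨(V, k, I, j), hs, hj⟩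
  have hcorrect : ∀ n c, Valid (n, c) → (Answer (n, c) ↔
      ∃ x : G, P ((A n).filter fun a => Path (E n) (Nat.pair a 0) x (Nat.pair a 1)) n) := by
    rintro n c ⟨hs, hj⟩
    exact (hs.exists_iff hφ hCφ (hcomp n) hout hj fun L => P L n).symm
  -- The search runs through all numbers until one decodes to a valid certificate; which one is
  -- found does not affect the answer.
  let code : ℕ → ℕ → Option Bool := fun n m => (Encodable.decode (α := Cert) m).bind fun c =>
    if Valid (n, c) then some (decide (Answer (n, c))) else none
  have hcode : Primrec₂ code := by
    refine Primrec.option_bind (Primrec.decode.comp Primrec.snd) ?_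
    have hz : Primrec fun z : (ℕ × ℕ) × Cert => (z.1.1, z.2) :=
      (Primrec.fst.comp Primrec.fst).pair Primrec.snd
    exact Primrec.ite (hValid.comp hz) (Primrec.option_some.comp (hAnswer.decide.comp hz))
      (Primrec.const none)
  have hsome : ∀ n m b, code n m = some b → (b = true ↔
      ∃ x : G, P ((A n).filter fun a => Path (E n) (Nat.pair a 0) x (Nat.pair a 1)) n) := by
    intro n m b h
    obtain ⟨c, -, hc⟩ := Option.bind_eq_some_iff.1 h
    split_ifs at hc with hv
    rw [← hcorrect n c hv, ← Option.some.inj hc, decide_eq_true_iff]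
  have hdom : ∀ n, ∃ m, (code n m).isSome := by
    intro n
    obtain ⟨c, hc⟩ := hex n
    exact ⟨Encodable.encode c, by simp [code, hc]⟩
  have hpart : Partrec fun n => Nat.rfindOpt (code n) := Partrec.rfindOpt hcode.to_comp
  have htot : ∀ n, (Nat.rfindOpt (code n)).Dom := fun n => by
    obtain ⟨m, hm⟩ := hdom n
    obtain ⟨b, hb⟩ := Option.isSome_iff_exists.1 hm
    exact Nat.rfindOpt_dom.2 ⟨m, b, hb⟩
  refine ⟨fun n => (Nat.rfindOpt (code n)).get (htot n), ?_, fun n => ?_⟩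
  · exact Partrec.of_eq hpart fun n => (Part.some_get (htot n)).symm
  · obtain ⟨m, hm⟩ := Nat.rfindOpt_spec (Part.get_mem (htot n))
    exact hsome n m _ hm

end Checking

/-! ### Automata for finite sets, unions, products and stars. -/

section Constructions

variable {G : Type*}

/-- Renames the states of an automaton. -/
def renameStates (i : ℕ → ℕ) (E : List (ℕ × G × ℕ)) : List (ℕ × G × ℕ) :=
  E.map fun e => (i e.1, e.2.1, i e.2.2)

theorem mem_renameStates {i : ℕ → ℕ} {E : List (ℕ × G × ℕ)} {e : ℕ × G × ℕ} :
    e ∈ renameStates i E ↔ ∃ p g q, (p, g, q) ∈ E ∧ e = (i p, g, i q) := by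
  simp [renameStates, eq_comm]

theorem primrec_renameStates {α : Type*} [Primcodable α] [Primcodable G] {i : α → ℕ → ℕ}
    {E : α → List (ℕ × G × ℕ)} (hi : Primrec₂ i) (hE : Primrec E) :
    Primrec fun a => renameStates (i a) (E a) := by
  refine Primrec.list_map hE ?_
  have he : Primrec fun z : α × ℕ × G × ℕ => z.2 := Primrec.snd
  exact (hi.comp Primrec.fst (Primrec.fst.comp he)).pair
    ((Primrec.fst.comp (Primrec.snd.comp he)).pair
      (hi.comp Primrec.fst (Primrec.snd.comp (Primrec.snd.comp he))))

variable [Group G]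

theorem Path.rename {E E' : List (ℕ × G × ℕ)} {p q : ℕ} {g : G} (h : Path E p g q)
    {i : ℕ → ℕ} (hi : renameStates i E ⊆ E') : Path E' (i p) g (i q) :=
  h.map i fun e he => hi (mem_renameStates.2 ⟨e.1, e.2.1, e.2.2, he, rfl⟩)

/-- Automata start in state `0` and accept in state `1`. This one accepts the members of a
list. -/
def listNfa (l : List G) : List (ℕ × G × ℕ) := l.map fun g => (0, g, 1)

/-- The automaton for a union. -/
def unionNfa (E₁ E₂ : List (ℕ × G × ℕ)) : List (ℕ × G × ℕ) :=
  [(0, 1, 2), (0, 1, 3), (4, 1, 1), (5, 1, 1)] ++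
    (renameStates (2 * · + 2) E₁ ++ renameStates (2 * · + 3) E₂)

/-- The automaton for the product of two sets with a group element in between. -/
def concatNfa (E₁ : List (ℕ × G × ℕ)) (g : G) (E₂ : List (ℕ × G × ℕ)) : List (ℕ × G × ℕ) :=
  [(0, 1, 2), (4, g, 3), (5, 1, 1)] ++ (renameStates (2 * · + 2) E₁ ++ renameStates (2 * · + 3) E₂)

/-- The automaton for the generated submonoid. -/
def starNfa (E : List (ℕ × G × ℕ)) : List (ℕ × G × ℕ) :=
  [(0, 1, 3), (3, 1, 2), (4, 1, 3), (3, 1, 1)] ++ renameStates (2 * · + 2) E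

theorem path_listNfa {l : List G} {x : G} : Path (listNfa l) 0 x 1 ↔ x ∈ l := by
  constructor
  · intro h
    have := h.mem_of_invariant (x := 1)
      (Y := fun q => {x | q = 0 ∧ x = 1 ∨ q = 1 ∧ x ∈ l}) ?_ (by simp)
    · simpa using this
    · rintro e he x hx
      obtain ⟨g, hg, rfl⟩ := List.mem_map.1 he
      rcases hx with ⟨-, rfl⟩ | ⟨h, -⟩
      · right; simpa using hg
      · simp at h
  · intro h
    exact Path.single (List.mem_map.2 ⟨x, h, rfl⟩)

/-- The renamings leave 0 and 1 free; the old initial and accepting states become 2 and 4,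
respectively 3 and 5. That nothing else is accepted follows from an invariant describing what can be
read at each state. -/
theorem path_unionNfa {E₁ E₂ : List (ℕ × G × ℕ)} {x : G} :
    Path (unionNfa E₁ E₂) 0 x 1 ↔ Path E₁ 0 x 1 ∨ Path E₂ 0 x 1 := by
  constructor
  · intro h
    have := h.mem_of_invariant (x := 1)
      (Y := fun q => {x | q = 0 ∧ x = 1 ∨ (∃ p, q = 2 * p + 2 ∧ Path E₁ 0 x p) ∨
        (∃ p, q = 2 * p + 3 ∧ Path E₂ 0 x p) ∨ q = 1 ∧ (Path E₁ 0 x 1 ∨ Path E₂ 0 x 1)}) ?_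
      (by simp)
    · rw [one_mul] at this
      rcases this with ⟨h, -⟩ | ⟨p, h, -⟩ | ⟨p, h, -⟩ | ⟨-, h⟩
      · omega
      · omega
      · omega
      · exact h
    · rintro e he x hx
      simp only [unionNfa, List.mem_append, List.mem_cons, List.not_mem_nil, or_false,
        mem_renameStates] at he
      rcases he with (rfl | rfl | rfl | rfl) | ⟨p, g, q, he, rfl⟩ | ⟨p, g, q, he, rfl⟩ <;>
        rcases hx with ⟨h, h'⟩ | ⟨p', h, h'⟩ | ⟨p', h, h'⟩ | ⟨h, h'⟩ <;> simp only at h <;>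
        try omega
      · exact Or.inr (Or.inl ⟨0, rfl, by simpa [h'] using Path.nil 0⟩)
      · exact Or.inr (Or.inr (Or.inl ⟨0, rfl, by simpa [h'] using Path.nil 0⟩))
      · obtain rfl : p' = 1 := by omega
        exact Or.inr (Or.inr (Or.inr ⟨rfl, Or.inl (by simpa using h')⟩))
      · obtain rfl : p' = 1 := by omega
        exact Or.inr (Or.inr (Or.inr ⟨rfl, Or.inr (by simpa using h')⟩))
      · obtain rfl : p' = p := by omega
        exact Or.inr (Or.inl ⟨q, rfl, h'.trans (Path.single he)⟩)
      · obtain rfl : p' = p := by omega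
        exact Or.inr (Or.inr (Or.inl ⟨q, rfl, h'.trans (Path.single he)⟩))
  · have hsub : ∀ i ∈ [(0, 1, 2), (0, 1, 3), (4, 1, 1), (5, 1, 1)], i ∈ unionNfa E₁ E₂ :=
      fun i hi => List.mem_append_left _ hi
    rintro (h | h)
    · have h2 := h.rename (i := (2 * · + 2)) (E' := unionNfa E₁ E₂) (by
        intro e he; exact List.mem_append_right _ (List.mem_append_left _ he))
      simpa using ((Path.single (hsub (0, 1, 2) (by simp))).trans h2).trans
        (Path.single (hsub (4, 1, 1) (by simp)))
    · have h2 := h.rename (i := (2 * · + 3)) (E' := unionNfa E₁ E₂) (by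
        intro e he; exact List.mem_append_right _ (List.mem_append_right _ he))
      simpa using ((Path.single (hsub (0, 1, 3) (by simp))).trans h2).trans
        (Path.single (hsub (5, 1, 1) (by simp)))

/-- All states are covered, not just the accepting one, because the bound on denominators concerns
unfinished runs as well. -/
theorem Path.concatNfa_cases {E₁ E₂ : List (ℕ × G × ℕ)} {g x : G} {q : ℕ}
    (h : Path (concatNfa E₁ g E₂) 0 x q) : q = 0 ∧ x = 1 ∨ (∃ p, q = 2 * p + 2 ∧ Path E₁ 0 x p) ∨
      (∃ p, q = 2 * p + 3 ∧ ∃ y z, Path E₁ 0 y 1 ∧ Path E₂ 0 z p ∧ x = y * g * z) ∨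
      q = 1 ∧ ∃ y z, Path E₁ 0 y 1 ∧ Path E₂ 0 z 1 ∧ x = y * g * z := by
  have := h.mem_of_invariant (x := 1)
    (Y := fun q => {x | q = 0 ∧ x = 1 ∨ (∃ p, q = 2 * p + 2 ∧ Path E₁ 0 x p) ∨
      (∃ p, q = 2 * p + 3 ∧ ∃ y z, Path E₁ 0 y 1 ∧ Path E₂ 0 z p ∧ x = y * g * z) ∨
      q = 1 ∧ ∃ y z, Path E₁ 0 y 1 ∧ Path E₂ 0 z 1 ∧ x = y * g * z}) ?_ (by simp)
  · rwa [one_mul] at this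
  · rintro e he x hx
    simp only [concatNfa, List.mem_append, List.mem_cons, List.not_mem_nil, or_false,
      mem_renameStates] at he
    rcases he with (rfl | rfl | rfl) | ⟨p, g', q, he, rfl⟩ | ⟨p, g', q, he, rfl⟩ <;>
      rcases hx with ⟨h, h'⟩ | ⟨p', h, h'⟩ | ⟨p', h, h'⟩ | ⟨h, h'⟩ <;> simp only at h <;>
      try omega
    · exact Or.inr (Or.inl ⟨0, rfl, by simpa [h'] using Path.nil 0⟩)
    · obtain rfl : p' = 1 := by omega
      exact Or.inr (Or.inr (Or.inl ⟨0, rfl, x, 1, h', Path.nil 0, by simp⟩))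
    · obtain rfl : p' = 1 := by omega
      exact Or.inr (Or.inr (Or.inr ⟨rfl, by simpa using h'⟩))
    · obtain rfl : p' = p := by omega
      exact Or.inr (Or.inl ⟨q, rfl, h'.trans (Path.single he)⟩)
    · obtain rfl : p' = p := by omega
      obtain ⟨y, z, hy, hz, rfl⟩ := h'
      exact Or.inr (Or.inr (Or.inl ⟨q, rfl, y, z * g', hy, hz.trans (Path.single he),
        by simp [mul_assoc]⟩))

theorem path_concatNfa {E₁ E₂ : List (ℕ × G × ℕ)} {g x : G} : Path (concatNfa E₁ g E₂) 0 x 1 ↔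
    ∃ y z, Path E₁ 0 y 1 ∧ Path E₂ 0 z 1 ∧ x = y * g * z := by
  constructor
  · intro h
    rcases h.concatNfa_cases with ⟨h, -⟩ | ⟨p, h, -⟩ | ⟨p, h, -⟩ | ⟨-, h⟩
    · omega
    · omega
    · omega
    · exact h
  · rintro ⟨y, z, hy, hz, rfl⟩
    have hsub : ∀ i ∈ [(0, 1, 2), (4, g, 3), (5, 1, 1)], i ∈ concatNfa E₁ g E₂ :=
      fun i hi => List.mem_append_left _ hi
    have h1 := hy.rename (i := (2 * · + 2)) (E' := concatNfa E₁ g E₂) (by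
      intro e he; exact List.mem_append_right _ (List.mem_append_left _ he))
    have h2 := hz.rename (i := (2 * · + 3)) (E' := concatNfa E₁ g E₂) (by
      intro e he; exact List.mem_append_right _ (List.mem_append_right _ he))
    simpa using ((((Path.single (hsub (0, 1, 2) (by simp))).trans h1).trans
      (Path.single (hsub (4, g, 3) (by simp)))).trans h2).trans
        (Path.single (hsub (5, 1, 1) (by simp)))

/-- State 3 is a hub that no renamed state `2p + 2` meets; whatever is read on returning to it is a
product of accepted elements. -/
theorem path_starNfa {E : List (ℕ × G × ℕ)} {x : G} :
    Path (starNfa E) 0 x 1 ↔ x ∈ Submonoid.closure {y | Path E 0 y 1} := by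
  constructor
  · intro h
    have := h.mem_of_invariant (x := 1)
      (Y := fun q => {x | (∃ p, q = 2 * p + 2 ∧
        ∃ y ∈ Submonoid.closure {y | Path E 0 y 1}, ∃ z, Path E 0 z p ∧ x = y * z) ∨
        (q = 0 ∨ q = 1 ∨ q = 3) ∧ x ∈ Submonoid.closure {y | Path E 0 y 1}}) ?_
      (by simp)
    · rw [one_mul] at this
      rcases this with ⟨p, h, -⟩ | ⟨-, h⟩
      · omega
      · exact h
    · rintro e he x hx
      simp only [starNfa, List.mem_append, List.mem_cons, List.not_mem_nil, or_false,
        mem_renameStates] at he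
      rcases he with (rfl | rfl | rfl | rfl) | ⟨p, g, q, he, rfl⟩ <;>
        rcases hx with ⟨p', h, h'⟩ | ⟨h, h'⟩ <;> simp only at h <;>
        try omega
      · exact Or.inr ⟨by simp, by simpa using h'⟩
      · exact Or.inl ⟨0, rfl, x, h', 1, Path.nil 0, rfl⟩
      · obtain rfl : p' = 1 := by omega
        obtain ⟨y, hy, z, hz, rfl⟩ := h'
        exact Or.inr ⟨by simp, by simpa using mul_mem hy (Submonoid.subset_closure hz)⟩
      · exact Or.inr ⟨by simp, by simpa using h'⟩
      · obtain rfl : p' = p := by omega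
        obtain ⟨y, hy, z, hz, rfl⟩ := h'
        exact Or.inl ⟨q, rfl, y, hy, z * g, hz.trans (Path.single he), by simp [mul_assoc]⟩
  · intro h
    have hsub : ∀ i ∈ [(0, 1, 3), (3, 1, 2), (4, 1, 3), (3, 1, 1)], i ∈ starNfa E :=
      fun i hi => List.mem_append_left _ hi
    have hloop : Path (starNfa E) 3 x 3 := by
      induction h using Submonoid.closure_induction with
      | mem y hy =>
        have h1 := Path.rename hy (i := (2 * · + 2)) (E' := starNfa E) (by
          intro e he; exact List.mem_append_right _ he)
        simpa using ((Path.single (hsub (3, 1, 2) (by simp))).trans h1).trans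
          (Path.single (hsub (4, 1, 3) (by simp)))
      | one => exact Path.nil 3
      | mul y z _ _ hy hz => exact hy.trans hz
    simpa using ((Path.single (hsub (0, 1, 3) (by simp))).trans hloop).trans
      (Path.single (hsub (3, 1, 1) (by simp)))

/-- A submonoid that contains all labels contains the labels of all paths. -/
theorem Path.mem_submonoid {E : List (ℕ × G × ℕ)} {N : Submonoid G}
    (hE : ∀ e ∈ E, e.2.1 ∈ N) {p q : ℕ} {x : G} (h : Path E p x q) : x ∈ N := by
  simpa using h.mem_of_invariant (Y := fun _ => (N : Set G))
    (fun e he _ hx => mul_mem hx (hE e he)) (x := 1) N.one_mem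

theorem primrec_affine {α : Type*} [Primcodable α] (c : ℕ) :
    Primrec₂ fun (_ : α) (p : ℕ) => 2 * p + c :=
  Primrec.nat_add.comp (Primrec.nat_mul.comp (Primrec.const 2) Primrec.snd) (Primrec.const c)

section Primrec

variable {α : Type*} [Primcodable α] [Primcodable G]

theorem primrec_unionNfa {E₁ E₂ : α → List (ℕ × G × ℕ)} (h₁ : Primrec E₁) (h₂ : Primrec E₂) :
    Primrec fun a => unionNfa (E₁ a) (E₂ a) :=
  Primrec.list_append.comp (Primrec.const _) (Primrec.list_append.comp
    (primrec_renameStates (primrec_affine 2) h₁) (primrec_renameStates (primrec_affine 3) h₂))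

theorem primrec_concatNfa {E₁ E₂ : α → List (ℕ × G × ℕ)} {g : α → G} (h₁ : Primrec E₁)
    (hg : Primrec g) (h₂ : Primrec E₂) : Primrec fun a => concatNfa (E₁ a) (g a) (E₂ a) :=
  Primrec.list_append.comp (Primrec.list_cons.comp (Primrec.const _) (Primrec.list_cons.comp
    ((Primrec.const 4).pair (hg.pair (Primrec.const 3))) (Primrec.const _)))
    (Primrec.list_append.comp (primrec_renameStates (primrec_affine 2) h₁)
      (primrec_renameStates (primrec_affine 3) h₂))

theorem primrec_starNfa {E : α → List (ℕ × G × ℕ)} (h : Primrec E) :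
    Primrec fun a => starNfa (E a) :=
  Primrec.list_append.comp (Primrec.const _) (primrec_renameStates (primrec_affine 2) h)

end Primrec

end Constructions

/-! ### From codes of expressions to automata. -/

section Translation

open Classical in
/-- The automaton of the rational expression over `GL(2,ℤ)` with the given code. -/
noncomputable def ratNfa : ℕ → List (ℕ × GL (Fin 2) ℚ × ℕ) :=
  treeRec (fun m => listNfa (((Encodable.decode (α := List (GL (Fin 2) ℚ)) m).getD []).filter
      fun g => g ∈ GL2Z))
    fun t _ x y z => if t = 1 then unionNfa y z else if t = 2 then concatNfa y 1 z else starNfa x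

theorem primrec_ratNfa : Primrec ratNfa := by
  classical
  have h : Primrec₂ fun (_ : Unit) n => ratNfa n := by
    refine primrec_treeRec ?_ ?_
    · refine Primrec.list_map (primrec_list_filter (Primrec.option_getD.comp
        (Primrec.decode.comp Primrec.snd) (Primrec.const []))
        (primrecPred_mem_GL2Z.comp Primrec.snd)) ?_
      exact (Primrec.const 0).pair (Primrec.snd.pair (Primrec.const 1))
    · let X := Unit × (ℕ × ℕ) × List (ℕ × GL (Fin 2) ℚ × ℕ) × List (ℕ × GL (Fin 2) ℚ × ℕ) ×
        List (ℕ × GL (Fin 2) ℚ × ℕ)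
      have ht : Primrec fun z : X => z.2.1.1 :=
        Primrec.fst.comp (Primrec.fst.comp Primrec.snd)
      have hc : Primrec fun z : X => z.2.2 := Primrec.snd.comp Primrec.snd
      have hy := Primrec.fst.comp (Primrec.snd.comp hc)
      have hz := Primrec.snd.comp (Primrec.snd.comp hc)
      exact Primrec.ite (Primrec.eq.comp ht (Primrec.const 1)) (primrec_unionNfa hy hz)
        (Primrec.ite (Primrec.eq.comp ht (Primrec.const 2))
          (primrec_concatNfa hy (Primrec.const 1) hz) (primrec_starNfa (Primrec.fst.comp hc)))
  exact h.comp (Primrec.const ()) Primrec.id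

/-- The filter in the definition of `ratNfa` makes this true for every number, including those that
code no expression. -/
theorem labels_ratNfa (n : ℕ) : ∀ e ∈ ratNfa n, e.2.1 ∈ GL2Z := by
  refine treeRec_induction _ _
    (P := fun (_ : ℕ) (E : List (ℕ × GL (Fin 2) ℚ × ℕ)) => ∀ e ∈ E, e.2.1 ∈ GL2Z) ?_ ?_ n
  · intro m e he
    obtain ⟨g, hg, rfl⟩ := List.mem_map.1 he
    simpa using (List.mem_filter.1 hg).2
  · have hrel : ∀ (i : ℕ → ℕ) (E : List (ℕ × GL (Fin 2) ℚ × ℕ)), (∀ e ∈ E, e.2.1 ∈ GL2Z) →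
        ∀ e ∈ renameStates i E, e.2.1 ∈ GL2Z := by
      intro i E hE e he
      obtain ⟨p, g, q, he', rfl⟩ := mem_renameStates.1 he
      exact hE (p, g, q) he'
    intro t m x y z hx hy hz e he
    split_ifs at he <;>
      simp only [unionNfa, concatNfa, starNfa, List.mem_append, List.mem_cons,
        List.not_mem_nil, or_false] at he
    · rcases he with (rfl | rfl | rfl | rfl) | he | he
      exacts [one_mem _, one_mem _, one_mem _, one_mem _, hrel _ _ hy e he, hrel _ _ hz e he]
    · rcases he with (rfl | rfl | rfl) | he | he
      exacts [one_mem _, one_mem _, one_mem _, hrel _ _ hy e he, hrel _ _ hz e he]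
    · rcases he with (rfl | rfl | rfl | rfl) | he
      exacts [one_mem _, one_mem _, one_mem _, one_mem _, hrel _ _ hx e he]

/-- Expressions code a list through the codes of its members; this agrees with the encoding of the
list itself, so decoding recovers the matrices. -/
theorem encode_map_encode {α : Type*} [Encodable α] (l : List α) :
    Encodable.encode (l.map (Encodable.encode : α → ℕ)) = Encodable.encode l := by
  induction l with
  | nil => rfl
  | cons a l ih => simp [ih]

theorem path_ratNfa (e : RatExpr GL2Z) (x : GL (Fin 2) ℚ) :
    Path (ratNfa (e.code fun h : GL2Z => matCode h)) 0 x 1 ↔ x ∈ ((↑) '' e.eval : Set _) := by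
  induction e generalizing x with
  | finite l =>
    have h : Encodable.encode (l.map fun h : GL2Z => matCode h) =
        Encodable.encode (l.map ((↑) : GL2Z → GL (Fin 2) ℚ)) := by
      rw [← encode_map_encode (l.map ((↑) : GL2Z → GL (Fin 2) ℚ)), List.map_map]
      rfl
    rw [RatExpr.code, ratNfa, treeRec_leaf, path_listNfa, h, Encodable.encodek]
    simp [RatExpr.eval]
  | union e₁ e₂ ih₁ ih₂ =>
    rw [RatExpr.code, ratNfa, treeRec_node _ _ 0]
    simp only [Nat.unpair_pair]
    rw [if_pos trivial, path_unionNfa]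
    change Path (ratNfa _) _ _ _ ∨ Path (ratNfa _) _ _ _ ↔ _
    rw [ih₁, ih₂, RatExpr.eval, Set.image_union]
    rfl
  | mul e₁ e₂ ih₁ ih₂ =>
    rw [RatExpr.code, ratNfa, treeRec_node _ _ 1]
    simp only [Nat.unpair_pair]
    rw [if_neg (by norm_num), if_pos trivial, path_concatNfa]
    change (∃ y z, Path (ratNfa _) _ _ _ ∧ Path (ratNfa _) _ _ _ ∧ _) ↔ _
    simp only [ih₁, ih₂, RatExpr.eval]
    constructor
    · rintro ⟨_, _, ⟨y, hy, rfl⟩, ⟨z, hz, rfl⟩, rfl⟩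
      exact ⟨y * z, Set.mul_mem_mul hy hz, by simp⟩
    · rintro ⟨_, ⟨y, hy, z, hz, rfl⟩, rfl⟩
      exact ⟨y, z, ⟨y, hy, rfl⟩, ⟨z, hz, rfl⟩, by simp⟩
  | star e ih =>
    rw [RatExpr.code, ratNfa, treeRec_node _ _ 2]
    rw [if_neg (by norm_num), if_neg (by norm_num), path_starNfa]
    change x ∈ Submonoid.closure {y | Path (ratNfa _) 0 y 1} ↔ _
    simp only [ih, RatExpr.eval]
    have h := MonoidHom.map_mclosure GL2Z.subtype e.eval
    change x ∈ Submonoid.closure (GL2Z.subtype '' e.eval) ↔ _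
    rw [← h]
    rfl

/-- The automaton of the formal product with the given code. -/
noncomputable def flatNfa : ℕ → List (ℕ × GL (Fin 2) ℚ × ℕ) :=
  treeRec ratNfa fun _ m _ y _ => concatNfa y ((Encodable.decode m.unpair.2.unpair.1).getD 1)
    (ratNfa m.unpair.2.unpair.2)

theorem primrec_flatNfa : Primrec flatNfa := by
  have h : Primrec₂ fun (_ : Unit) n => flatNfa n := by
    refine primrec_treeRec (primrec_ratNfa.comp Primrec.snd) ?_
    let X := Unit × (ℕ × ℕ) × List (ℕ × GL (Fin 2) ℚ × ℕ) × List (ℕ × GL (Fin 2) ℚ × ℕ) ×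
      List (ℕ × GL (Fin 2) ℚ × ℕ)
    have hm : Primrec fun z : X => z.2.1.2.unpair.2.unpair := Primrec.unpair.comp
      (Primrec.snd.comp (Primrec.unpair.comp (Primrec.snd.comp (Primrec.fst.comp Primrec.snd))))
    have hc : Primrec fun z : X => z.2.2 := Primrec.snd.comp Primrec.snd
    exact primrec_concatNfa (Primrec.fst.comp (Primrec.snd.comp hc))
      (Primrec.option_getD.comp (Primrec.decode.comp (Primrec.fst.comp hm)) (Primrec.const 1))
      (primrec_ratNfa.comp (Primrec.snd.comp hm))
  exact h.comp (Primrec.const ()) Primrec.id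

theorem path_flatNfa (t : FlatTerm GL2Z) (x : GL (Fin 2) ℚ) :
    Path (flatNfa (t.code matCode)) 0 x 1 ↔ x ∈ t.eval := by
  induction t generalizing x with
  | base e =>
    rw [FlatTerm.code, flatNfa, treeRec_leaf]
    exact path_ratNfa e x
  | snoc p g e ih =>
    rw [FlatTerm.code, flatNfa, treeRec_node _ _ 0]
    simp only [Nat.unpair_pair]
    rw [path_concatNfa, ← encode_eq_matCode, Encodable.encodek]
    change (∃ y z, Path (flatNfa _) _ _ _ ∧ _ ∧ _) ↔ _
    simp only [ih, path_ratNfa, FlatTerm.eval, Option.getD_some]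
    constructor
    · rintro ⟨y, z, hy, hz, rfl⟩
      exact Set.mul_mem_mul (Set.mul_mem_mul hy rfl) hz
    · rintro ⟨_, ⟨y, hy, _, rfl, rfl⟩, z, hz, rfl⟩
      exact ⟨y, z, hy, hz, rfl⟩

/-- The codes of the formal products in the Boolean expression with the given code. -/
def atoms : ℕ → List ℕ :=
  treeRec (fun m => (Encodable.decode (α := List ℕ) m).getD [])
    fun t _ x y z => if t = 3 then x else y ++ z

theorem primrec_atoms : Primrec atoms := by
  have h : Primrec₂ fun (_ : Unit) n => atoms n := by
    refine primrec_treeRec (Primrec.option_getD.comp (Primrec.decode.comp Primrec.snd)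
      (Primrec.const [])) ?_
    let X := Unit × (ℕ × ℕ) × List ℕ × List ℕ × List ℕ
    have ht : Primrec fun z : X => z.2.1.1 := Primrec.fst.comp (Primrec.fst.comp Primrec.snd)
    have hc : Primrec fun z : X => z.2.2 := Primrec.snd.comp Primrec.snd
    exact Primrec.ite (Primrec.eq.comp ht (Primrec.const 3)) (Primrec.fst.comp hc)
      (Primrec.list_append.comp (Primrec.fst.comp (Primrec.snd.comp hc))
        (Primrec.snd.comp (Primrec.snd.comp hc)))
  exact h.comp (Primrec.const ()) Primrec.id

open Classical in
/-- The truth value of the Boolean expression with the given code at an element that belongs to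
the formal products with codes in `L`. -/
noncomputable def truth (L : List ℕ) : ℕ → Bool :=
  treeRec (fun m => decide (∃ a ∈ (Encodable.decode (α := List ℕ) m).getD [], a ∈ L))
    fun t _ x y z => if t = 1 then y || z else if t = 2 then y && z else !x

theorem primrec_truth : Primrec₂ truth := by
  classical
  refine primrec_treeRec ?_ ?_
  · refine PrimrecPred.decide (primrecPred_exists_mem (Primrec.option_getD.comp
      (Primrec.decode.comp Primrec.snd) (Primrec.const [])) ?_)
    exact primrecPred_mem (Primrec.fst.comp Primrec.fst) Primrec.snd
  · let X := List ℕ × (ℕ × ℕ) × Bool × Bool × Bool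
    have ht : Primrec fun z : X => z.2.1.1 := Primrec.fst.comp (Primrec.fst.comp Primrec.snd)
    have hc : Primrec fun z : X => z.2.2 := Primrec.snd.comp Primrec.snd
    have hy := Primrec.fst.comp (Primrec.snd.comp hc)
    have hz := Primrec.snd.comp (Primrec.snd.comp hc)
    exact Primrec.ite (Primrec.eq.comp ht (Primrec.const 1)) (Primrec.or.comp hy hz)
      (Primrec.ite (Primrec.eq.comp ht (Primrec.const 2)) (Primrec.and.comp hy hz)
        (Primrec.not.comp (Primrec.fst.comp hc)))

/-- `L` has to be correct only on the atoms of the expression. -/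
theorem truth_iff (b : BoolExpr GL2Z) (x : GL (Fin 2) ℚ) {L : List ℕ}
    (hL : ∀ a ∈ atoms (b.code matCode), a ∈ L ↔ Path (flatNfa a) 0 x 1) :
    truth L (b.code matCode) = true ↔ x ∈ b.eval := by
  induction b with
  | flat l =>
    rw [BoolExpr.code] at hL ⊢
    rw [atoms, treeRec_leaf, Encodable.encodek] at hL
    rw [truth, treeRec_leaf, Encodable.encodek, decide_eq_true_iff]
    simp only [Option.getD_some] at hL ⊢
    rw [BoolExpr.eval]
    constructor
    · rintro ⟨a, ha, haL⟩
      rw [hL a ha] at haL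
      obtain ⟨t, ht, rfl⟩ := List.mem_map.1 ha
      exact ⟨t, ht, (path_flatNfa t x).1 haL⟩
    · rintro ⟨t, ht, hx⟩
      have ha : t.code matCode ∈ l.map (FlatTerm.code matCode) := List.mem_map.2 ⟨t, ht, rfl⟩
      exact ⟨_, ha, (hL _ ha).2 ((path_flatNfa t x).2 hx)⟩
  | union b₁ b₂ ih₁ ih₂ =>
    rw [BoolExpr.code] at hL ⊢
    rw [atoms, treeRec_node _ _ 0, if_neg (by norm_num)] at hL
    simp only [Nat.unpair_pair] at hL
    rw [truth, treeRec_node _ _ 0, if_pos rfl]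
    simp only [Nat.unpair_pair]
    rw [Bool.or_eq_true, BoolExpr.eval]
    exact or_congr (ih₁ fun a ha => hL a (List.mem_append_left _ ha))
      (ih₂ fun a ha => hL a (List.mem_append_right _ ha))
  | inter b₁ b₂ ih₁ ih₂ =>
    rw [BoolExpr.code] at hL ⊢
    rw [atoms, treeRec_node _ _ 1, if_neg (by norm_num)] at hL
    simp only [Nat.unpair_pair] at hL
    rw [truth, treeRec_node _ _ 1, if_neg (by norm_num), if_pos rfl]
    simp only [Nat.unpair_pair]
    rw [Bool.and_eq_true, BoolExpr.eval]
    exact and_congr (ih₁ fun a ha => hL a (List.mem_append_left _ ha))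
      (ih₂ fun a ha => hL a (List.mem_append_right _ ha))
  | compl b ih =>
    rw [BoolExpr.code] at hL ⊢
    rw [atoms, treeRec_node _ _ 2, if_pos rfl] at hL
    rw [truth, treeRec_node _ _ 2, if_neg (by norm_num), if_neg (by norm_num),
      Bool.not_eq_true', ← Bool.not_eq_true, BoolExpr.eval, Set.mem_compl_iff]
    exact not_congr (ih hL)

/-- The disjoint union of the automata of all formal products in a Boolean expression. -/
noncomputable def totalNfa (n : ℕ) : List (ℕ × GL (Fin 2) ℚ × ℕ) :=
  (atoms n).flatMap fun a => renameStates (Nat.pair a) (flatNfa a)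

theorem primrec_totalNfa : Primrec totalNfa :=
  Primrec.list_flatMap primrec_atoms (primrec_renameStates
    (Primrec₂.natPair.comp (Primrec.snd.comp Primrec.fst) Primrec.snd)
    (primrec_flatNfa.comp Primrec.snd))

theorem mem_totalNfa {n : ℕ} {e : ℕ × GL (Fin 2) ℚ × ℕ} : e ∈ totalNfa n ↔
    ∃ a ∈ atoms n, ∃ p g q, (p, g, q) ∈ flatNfa a ∧ e = (Nat.pair a p, g, Nat.pair a q) := by
  simp only [totalNfa, List.mem_flatMap, mem_renameStates]

theorem totalNfa_component (n : ℕ) :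
    ∀ e ∈ totalNfa n, e.1.unpair.1 = e.2.2.unpair.1 := by
  intro e he
  obtain ⟨a, -, p, g, q, -, rfl⟩ := mem_totalNfa.1 he
  simp

theorem path_totalNfa_cases {n a q : ℕ} {x : GL (Fin 2) ℚ}
    (h : Path (totalNfa n) (Nat.pair a 0) x q) :
    ∃ p, q = Nat.pair a p ∧ Path (flatNfa a) 0 x p := by
  have := h.mem_of_invariant (x := 1)
    (Y := fun q => {x | ∃ p, q = Nat.pair a p ∧ Path (flatNfa a) 0 x p}) ?_ ⟨0, rfl, Path.nil 0⟩
  · rwa [one_mul] at this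
  · rintro e he x ⟨p', h, h'⟩
    obtain ⟨b, -, p, g, q, he', rfl⟩ := mem_totalNfa.1 he
    obtain ⟨rfl, rfl⟩ := Nat.pair_eq_pair.1 h
    exact ⟨q, rfl, h'.trans (Path.single he')⟩

theorem path_totalNfa {n a : ℕ} (ha : a ∈ atoms n) (x : GL (Fin 2) ℚ) :
    Path (totalNfa n) (Nat.pair a 0) x (Nat.pair a 1) ↔ Path (flatNfa a) 0 x 1 := by
  constructor
  · intro h
    obtain ⟨p, hp, h'⟩ := path_totalNfa_cases h
    obtain ⟨-, rfl⟩ := Nat.pair_eq_pair.1 hp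
    exact h'
  · intro h
    exact h.rename fun e he => List.mem_flatMap.2 ⟨a, ha, he⟩

end Translation

/-! ### Bounded denominators and finiteness of the set of cosets. -/

section Cosets

/-- All entries of `d • M` are integers. -/
def IntegralMul (d : ℕ) (M : Matrix (Fin 2) (Fin 2) ℚ) : Prop :=
  ∀ i j, ∃ z : ℤ, (d : ℚ) * M i j = z

theorem IntegralMul.mul_left {d : ℕ} {M : Matrix (Fin 2) (Fin 2) ℚ} (h : IntegralMul d M)
    (c : ℕ) : IntegralMul (c * d) M := fun i j => by
  obtain ⟨z, hz⟩ := h i j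
  exact ⟨c * z, by push_cast; rw [mul_assoc, hz]⟩

theorem IntegralMul.mul_right {d : ℕ} {M : Matrix (Fin 2) (Fin 2) ℚ} (h : IntegralMul d M)
    (c : ℕ) : IntegralMul (d * c) M := mul_comm c d ▸ h.mul_left c

theorem IntegralMul.mul {d d' : ℕ} {M M' : Matrix (Fin 2) (Fin 2) ℚ} (h : IntegralMul d M)
    (h' : IntegralMul d' M') : IntegralMul (d * d') (M * M') := fun i j => by
  choose z hz using h
  choose z' hz' using h'
  refine ⟨∑ k, z i k * z' k j, ?_⟩
  rw [Matrix.mul_apply, Finset.mul_sum]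
  push_cast
  refine Finset.sum_congr rfl fun k _ => ?_
  rw [← hz, ← hz']
  ring

theorem exists_integralMul (M : Matrix (Fin 2) (Fin 2) ℚ) : ∃ d : ℕ, d ≠ 0 ∧ IntegralMul d M := by
  refine ⟨∏ i, ∏ j, (M i j).den, ?_, fun i j => ?_⟩
  · exact Finset.prod_ne_zero_iff.2 fun i _ => Finset.prod_ne_zero_iff.2 fun j _ => (M i j).den_nz
  · obtain ⟨c, hc⟩ : (M i j).den ∣ ∏ i, ∏ j, (M i j).den :=
      (Finset.dvd_prod_of_mem (fun j => (M i j).den) (Finset.mem_univ j)).trans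
        (Finset.dvd_prod_of_mem (fun i => ∏ j, (M i j).den) (Finset.mem_univ i))
    refine ⟨c * (M i j).num, ?_⟩
    rw [hc]
    push_cast
    rw [← Rat.den_mul_eq_num (M i j)]
    ring

/-- The denominators of the elements of `X` and of their inverses are bounded. -/
def HasBoundedDenominators (X : Set (GL (Fin 2) ℚ)) : Prop :=
  ∃ d : ℕ, d ≠ 0 ∧ ∀ x ∈ X, IntegralMul d x.val ∧ IntegralMul d (x⁻¹).val

theorem HasBoundedDenominators.mono {X Y : Set (GL (Fin 2) ℚ)} (hX : HasBoundedDenominators X)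
    (h : Y ⊆ X) : HasBoundedDenominators Y := by
  obtain ⟨d, hd, hX⟩ := hX
  exact ⟨d, hd, fun x hx => hX x (h hx)⟩

theorem HasBoundedDenominators.union {X Y : Set (GL (Fin 2) ℚ)} (hX : HasBoundedDenominators X)
    (hY : HasBoundedDenominators Y) : HasBoundedDenominators (X ∪ Y) := by
  obtain ⟨d, hd, hX⟩ := hX
  obtain ⟨d', hd', hY⟩ := hY
  refine ⟨d * d', mul_ne_zero hd hd', ?_⟩
  rintro x (hx | hx)
  · exact ⟨(hX x hx).1.mul_right d', (hX x hx).2.mul_right d'⟩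
  · exact ⟨(hY x hx).1.mul_left d, (hY x hx).2.mul_left d⟩

open scoped Pointwise in
theorem HasBoundedDenominators.mul {X Y : Set (GL (Fin 2) ℚ)} (hX : HasBoundedDenominators X)
    (hY : HasBoundedDenominators Y) : HasBoundedDenominators (X * Y) := by
  obtain ⟨d, hd, hX⟩ := hX
  obtain ⟨d', hd', hY⟩ := hY
  refine ⟨d * d', mul_ne_zero hd hd', ?_⟩
  rintro _ ⟨x, hx, y, hy, rfl⟩
  refine ⟨(hX x hx).1.mul (hY y hy).1, ?_⟩
  simp only [mul_inv_rev, Units.val_mul]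
  rw [mul_comm d d']
  exact (hY y hy).2.mul (hX x hx).2

theorem hasBoundedDenominators_singleton (g : GL (Fin 2) ℚ) : HasBoundedDenominators {g} := by
  obtain ⟨d, hd, h⟩ := exists_integralMul g.val
  obtain ⟨d', hd', h'⟩ := exists_integralMul (g⁻¹).val
  refine ⟨d * d', mul_ne_zero hd hd', ?_⟩
  rintro x rfl
  exact ⟨h.mul_right d', h'.mul_left d⟩

theorem hasBoundedDenominators_GL2Z : HasBoundedDenominators GL2Z := by
  have h : ∀ x ∈ GL2Z, IntegralMul 1 x.val := by
    rintro _ ⟨h, rfl⟩ i j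
    exact ⟨h.val i j, by simp⟩
  refine ⟨1, one_ne_zero, fun x hx => ⟨h x hx, h _ ?_⟩⟩
  obtain ⟨g, rfl⟩ := hx
  exact ⟨g⁻¹, map_inv _ g⟩

theorem hasBoundedDenominators_iUnion {X : ℕ → Set (GL (Fin 2) ℚ)}
    (hX : ∀ a, HasBoundedDenominators (X a)) (l : List ℕ) :
    HasBoundedDenominators {x | ∃ a ∈ l, x ∈ X a} := by
  induction l with
  | nil => exact ⟨1, one_ne_zero, by simp⟩
  | cons a l ih =>
    refine ((hX a).union ih).mono ?_
    rintro x ⟨b, hb, hx⟩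
    rcases List.mem_cons.1 hb with rfl | hb
    · exact Or.inl hx
    · exact Or.inr ⟨b, hb, hx⟩

-- What is read along a prefix of a formal product is trivial, read in a shorter product, or an
-- element of such a product times a fixed matrix times an element of `GL(2,ℤ)`.
open scoped Pointwise in
theorem hasBoundedDenominators_flatNfa (n : ℕ) :
    HasBoundedDenominators {x | ∃ q, Path (flatNfa n) 0 x q} := by
  have hrat : ∀ m, HasBoundedDenominators {x | ∃ q, Path (ratNfa m) 0 x q} := fun m =>
    hasBoundedDenominators_GL2Z.mono fun x ⟨q, h⟩ => h.mem_submonoid (labels_ratNfa m)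
  refine treeRec_induction _ _ (P := fun (_ : ℕ) (E : List (ℕ × GL (Fin 2) ℚ × ℕ)) =>
    HasBoundedDenominators {x | ∃ q, Path E 0 x q}) hrat ?_ n
  intro t m _ y _ _ hy _
  generalize (Encodable.decode (α := GL (Fin 2) ℚ) m.unpair.2.unpair.1).getD 1 = g
  refine ((hasBoundedDenominators_singleton 1).union (hy.union
    ((hy.mul (hasBoundedDenominators_singleton g)).mul (hrat m.unpair.2.unpair.2)))).mono ?_
  rintro x ⟨q, h⟩
  rcases h.concatNfa_cases with ⟨-, h⟩ | ⟨p, -, h⟩ | ⟨p, -, y, z, hy, hz, rfl⟩ |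
    ⟨-, y, z, hy, hz, rfl⟩
  · exact Or.inl h
  · exact Or.inr (Or.inl ⟨p, h⟩)
  · exact Or.inr (Or.inr (Set.mul_mem_mul (Set.mul_mem_mul ⟨_, hy⟩ rfl) ⟨_, hz⟩))
  · exact Or.inr (Or.inr (Set.mul_mem_mul (Set.mul_mem_mul ⟨_, hy⟩ rfl) ⟨_, hz⟩))

/-- Write `x y⁻¹ = 1 + (x - y) y⁻¹`. In the modulus `4d²`, one factor `d` undoes the scaling of `x`
and `y`, and the other clears the denominators of `y⁻¹`. -/
theorem exists_one_add_four_mul {d : ℕ} (hd : d ≠ 0) {x y : GL (Fin 2) ℚ}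
    (hx : IntegralMul d x.val) (hy : IntegralMul d y.val) (hy' : IntegralMul d (y⁻¹).val)
    (h : ∀ i j, (((d : ℚ) * x.val i j).num : ZMod (4 * d * d)) = ((d : ℚ) * y.val i j).num) :
    ∃ W : Fin 2 → Fin 2 → ℤ, ∀ i j,
      (x * y⁻¹).val i j = (1 : Matrix (Fin 2) (Fin 2) ℚ) i j + 4 * W i j := by
  have hd' : (d : ℚ) ≠ 0 := by exact_mod_cast hd
  have hw : ∀ i j, ∃ w : ℤ, x.val i j - y.val i j = 4 * d * w := by
    intro i j
    obtain ⟨z, hz⟩ := hx i j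
    obtain ⟨z', hz'⟩ := hy i j
    have hij := h i j
    rw [hz, hz', Rat.num_intCast, Rat.num_intCast, eq_comm,
      ZMod.intCast_eq_intCast_iff_dvd_sub] at hij
    obtain ⟨w, hw⟩ := hij
    refine ⟨w, ?_⟩
    have hw' : (z : ℚ) - z' = 4 * d * d * w := by exact_mod_cast hw
    rw [← hz, ← hz'] at hw'
    apply mul_left_cancel₀ hd'
    linear_combination hw'
  choose w hw using hw
  choose v hv using hy'
  refine ⟨fun i j => ∑ l, w i l * v l j, fun i j => ?_⟩
  have h1 : (x * y⁻¹).val = 1 + (x.val - y.val) * (y⁻¹).val := by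
    rw [sub_mul, ← Units.val_mul, ← Units.val_mul, mul_inv_cancel]
    simp
  rw [h1, Matrix.add_apply, Matrix.mul_apply, Int.cast_sum, Finset.mul_sum]
  congr 1
  refine Finset.sum_congr rfl fun l _ => ?_
  rw [Matrix.sub_apply, hw, Int.cast_mul, ← hv]
  ring

/-- The quotient and its inverse are both integral and congruent to the identity modulo 4, so the
determinant is a unit congruent to 1 modulo 4, that is, 1. -/
theorem isSanov_mul_inv {d : ℕ} (hd : d ≠ 0) {x y : GL (Fin 2) ℚ}
    (hx : IntegralMul d x.val) (hx' : IntegralMul d (x⁻¹).val)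
    (hy : IntegralMul d y.val) (hy' : IntegralMul d (y⁻¹).val)
    (h : ∀ i j, (((d : ℚ) * x.val i j).num : ZMod (4 * d * d)) = ((d : ℚ) * y.val i j).num) :
    IsSanov (x * y⁻¹) := by
  obtain ⟨W, hW⟩ := exists_one_add_four_mul hd hx hy hy' h
  obtain ⟨U, hU⟩ := exists_one_add_four_mul hd hy hx hx' fun i j => (h i j).symm
  have hmul : (x * y⁻¹).val * (y * x⁻¹).val = 1 := by
    rw [← Units.val_mul]; simp
  have hdet := congrArg Matrix.det hmul
  rw [Matrix.det_mul, Matrix.det_one, Matrix.det_fin_two, Matrix.det_fin_two] at hdet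
  refine ⟨W 0 0, 2 * W 0 1, 2 * W 1 0, W 1 1, ?_, ?_, ?_, ?_, ?_⟩
  · rw [hW]; simp
  · rw [hW]; simp; ring
  · rw [hW]; simp; ring
  · rw [hW]; simp
  · simp only [hW, hU] at hdet ⊢
    simp only [Matrix.one_apply_eq, ne_eq, zero_ne_one, one_ne_zero, not_false_eq_true,
      Matrix.one_apply_ne, zero_add] at hdet ⊢
    have hZ : ((1 + 4 * W 0 0) * (1 + 4 * W 1 1) - 4 * W 0 1 * (4 * W 1 0)) *
        ((1 + 4 * U 0 0) * (1 + 4 * U 1 1) - 4 * U 0 1 * (4 * U 1 0)) = 1 := by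
      exact_mod_cast hdet
    have h1 := Int.isUnit_iff.1 (IsUnit.of_mul_eq_one _ hZ)
    have h2 : (1 + 4 * W 0 0) * (1 + 4 * W 1 1) - 4 * W 0 1 * (4 * W 1 0) =
        1 + 4 * (W 0 0 + W 1 1 + 4 * (W 0 0 * W 1 1) - 4 * (W 0 1 * W 1 0)) := by ring
    have h3 : (1 + 4 * W 0 0) * (1 + 4 * W 1 1) - 4 * W 0 1 * (4 * W 1 0) = 1 := by omega
    have h4 : (1 + 4 * W 0 0) * (1 + 4 * W 1 1) = 4 * W 0 1 * (4 * W 1 0) + 1 := by linarith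
    exact_mod_cast h4

/-- A set with bounded denominators meets only finitely many right cosets of the Sanov
subgroup. -/
theorem HasBoundedDenominators.exists_representatives {X : Set (GL (Fin 2) ℚ)}
    (hX : HasBoundedDenominators X) : ∃ T : Set (GL (Fin 2) ℚ), T.Finite ∧ 1 ∈ T ∧
      (∀ t ∈ T, ∀ t' ∈ T, ∀ f, t = sanov f * t' → t = t') ∧
      ∀ x ∈ X, ∃ t ∈ T, ∃ f, x = sanov f * t := by
  classical
  obtain ⟨d, hd, hX'⟩ := (hasBoundedDenominators_singleton 1).union hX
  let s : Setoid (GL (Fin 2) ℚ) :=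
    { r := fun x y => ∃ f, x = sanov f * y
      iseqv := ⟨fun x => ⟨1, by simp⟩, fun {x y} ⟨f, h⟩ => ⟨f⁻¹, by simp [h]⟩,
        fun {x y z} ⟨f, h⟩ ⟨f', h'⟩ => ⟨f * f', by rw [h, h', map_mul, mul_assoc]⟩⟩ }
  -- The trivial coset must be represented by 1, since the automata start there.
  let rep : GL (Fin 2) ℚ → GL (Fin 2) ℚ := fun x =>
    if s x 1 then 1 else (Quotient.mk s x).out
  have hrep : ∀ x, s x (rep x) := by
    intro x
    by_cases h : s x 1
    · simpa only [rep, if_pos h] using h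
    · simpa only [rep, if_neg h] using s.symm (Quotient.mk_out x)
  have hcongr : ∀ x y, s x y → rep x = rep y := by
    intro x y h
    have h1 : s x 1 ↔ s y 1 := ⟨fun h' => s.trans (s.symm h) h', fun h' => s.trans h h'⟩
    simp only [rep, h1, Quotient.sound h]
  have hone : rep 1 = 1 := if_pos (s.refl 1)
  refine ⟨rep '' ({1} ∪ X), ?_, ⟨1, Or.inl rfl, hone⟩, ?_, ?_⟩
  · have : NeZero (4 * d * d) := ⟨by positivity⟩
    -- Elements of `{1} ∪ X` with the same residues lie in the same coset, so there are no more
    -- representatives than residue patterns.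
    let κ : GL (Fin 2) ℚ → Fin 2 → Fin 2 → ZMod (4 * d * d) := fun x i j =>
      (((d : ℚ) * x.val i j).num : ZMod (4 * d * d))
    let σ : (Fin 2 → Fin 2 → ZMod (4 * d * d)) → GL (Fin 2) ℚ := fun c =>
      if h : ∃ x ∈ {1} ∪ X, κ x = c then rep h.choose else 1
    refine (Set.finite_range σ).subset ?_
    rintro _ ⟨x, hx, rfl⟩
    have h : ∃ y ∈ {1} ∪ X, κ y = κ x := ⟨x, hx, rfl⟩
    refine ⟨κ x, ?_⟩
    simp only [σ, dif_pos h]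
    obtain ⟨hy, hκ⟩ := h.choose_spec
    apply hcongr
    obtain ⟨f, hf⟩ := (isSanov_iff _).1 (isSanov_mul_inv hd (hX' _ hy).1 (hX' _ hy).2
      (hX' _ hx).1 (hX' _ hx).2 fun i j => congrFun (congrFun hκ i) j)
    exact ⟨f, by rw [hf]; simp⟩
  · rintro _ ⟨x, -, rfl⟩ _ ⟨y, -, rfl⟩ f h
    exact hcongr x y (s.trans (hrep x) (s.trans ⟨f, h⟩ (s.symm (hrep y))))
  · intro x hx
    exact ⟨rep x, ⟨x, Or.inr hx, rfl⟩, hrep x⟩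

theorem det_sanov (f : FreeGroup Bool) : (sanov f).val.det = 1 := by
  obtain ⟨-, -, -, -, -, -, -, -, h⟩ := isSanov_sanov f
  rw [Matrix.det_fin_two, h]
  ring

/-- Sanov matrices have determinant 1, so finitely many cosets realize only finitely many
determinants. -/
theorem exists_notMem_sanov_cosets (T : List (GL (Fin 2) ℚ)) :
    ∃ x, ∀ t ∈ T, ∀ f, x ≠ sanov f * t := by
  obtain ⟨q, hq⟩ := Infinite.exists_notMem_finset (insert 0 (T.map fun t => t.val.det).toFinset)
  simp only [Finset.mem_insert, List.mem_toFinset, List.mem_map, not_or, not_exists,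
    not_and] at hq
  refine ⟨Matrix.GeneralLinearGroup.mkOfDetNeZero !![q, 0; 0, 1]
    (by simpa [Matrix.det_fin_two_of] using hq.1), fun t ht f h => hq.2 t ht ?_⟩
  have h' := congrArg (fun g : GL (Fin 2) ℚ => g.val.det) h
  simp only [Units.val_mul, Matrix.det_mul, det_sanov, one_mul] at h'
  rw [← h']
  simp [Matrix.GeneralLinearGroup.mkOfDetNeZero, Matrix.det_fin_two_of]

end Cosets

/-! ### The decision procedure for `GL(2,ℚ)` over `GL(2,ℤ)`. -/

section Decision

theorem exists_computable_emptiness : ∃ f : ℕ → Bool, Computable f ∧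
    ∀ b : BoolExpr GL2Z, f (b.code matCode) = true ↔ b.eval = ∅ := by
  classical
  obtain ⟨f, hf, h⟩ := exists_computable_satisfiable (φ := sanov) (C := IsSanov)
    (E := totalNfa) (A := atoms) (P := fun L n => truth L n = true) primrec_gl_mul
    primrecPred_isSanov sanov_injective isSanov_iff exists_notMem_sanov_cosets primrec_totalNfa
    primrec_atoms (Primrec.eq.comp primrec_truth (Primrec.const true)) totalNfa_component
    (fun n => by
      obtain ⟨T, hT, h1, hsep, hcover⟩ := (hasBoundedDenominators_iUnion
        hasBoundedDenominators_flatNfa (atoms n)).exists_representatives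
      refine ⟨T, hT, h1, hsep, fun a ha x q hp => hcover x ⟨a, ha, ?_⟩⟩
      obtain ⟨p, -, hp'⟩ := path_totalNfa_cases hp
      exact ⟨p, hp'⟩)
  refine ⟨fun n => !f n, Primrec.not.to_comp.comp hf, fun b => ?_⟩
  rw [Bool.not_eq_true', ← Bool.not_eq_true, h, Set.eq_empty_iff_forall_notMem, not_exists]
  refine forall_congr' fun x => not_congr (truth_iff b x fun a ha => ?_)
  rw [List.mem_filter, decide_eq_true_iff, path_totalNfa ha]
  exact and_iff_right ha

end Decision

/-! ### Expressions describe exactly the Boolean combinations. -/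

section BooleanCombinations

variable {M : Type*} [Monoid M] {N : Submonoid M}

theorem isRational_iff (L : Set M) : IsRational L ↔ ∃ e : RatExpr M, e.eval = L := by
  constructor
  · intro h
    induction h with
    | finite L hL =>
      obtain ⟨s, rfl⟩ := hL.exists_finset_coe
      exact ⟨.finite s.toList, by ext x; simp [RatExpr.eval]⟩
    | union L₁ L₂ _ _ ih₁ ih₂ =>
      obtain ⟨e₁, rfl⟩ := ih₁
      obtain ⟨e₂, rfl⟩ := ih₂
      exact ⟨.union e₁ e₂, rfl⟩
    | mul L₁ L₂ _ _ ih₁ ih₂ =>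
      obtain ⟨e₁, rfl⟩ := ih₁
      obtain ⟨e₂, rfl⟩ := ih₂
      exact ⟨.mul e₁ e₂, rfl⟩
    | star L _ ih =>
      obtain ⟨e, rfl⟩ := ih
      exact ⟨.star e, rfl⟩
  · rintro ⟨e, rfl⟩
    induction e with
    | finite l => exact .finite _ (List.finite_toSet l)
    | union e₁ e₂ ih₁ ih₂ => exact .union _ _ ih₁ ih₂
    | mul e₁ e₂ ih₁ ih₂ => exact .mul _ _ ih₁ ih₂
    | star e ih => exact .star _ ih

theorem isFlatProduct_iff (P : Set M) : IsFlatProduct N P ↔ ∃ t : FlatTerm N, t.eval = P := by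
  constructor
  · intro h
    induction h with
    | base L hL =>
      obtain ⟨e, rfl⟩ := (isRational_iff L).1 hL
      exact ⟨.base e, rfl⟩
    | snoc P g L _ hL ih =>
      obtain ⟨t, rfl⟩ := ih
      obtain ⟨e, rfl⟩ := (isRational_iff L).1 hL
      exact ⟨.snoc t g e, rfl⟩
  · rintro ⟨t, rfl⟩
    induction t with
    | base e => exact .base _ ((isRational_iff _).2 ⟨e, rfl⟩)
    | snoc p g e ih => exact .snoc _ g _ ih ((isRational_iff _).2 ⟨e, rfl⟩)

theorem isFlatRational_iff (L : Set M) :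
    IsFlatRational N L ↔ ∃ l : List (FlatTerm N), (BoolExpr.flat l).eval = L := by
  constructor
  · rintro ⟨S, hS, hP, rfl⟩
    have : Nonempty (FlatTerm N) := ⟨.base (.finite [])⟩
    choose! t ht using fun P hPS => (isFlatProduct_iff P).1 (hP P hPS)
    refine ⟨hS.toFinset.toList.map t, ?_⟩
    ext x
    simp only [BoolExpr.eval, List.mem_map, Finset.mem_toList, Set.Finite.mem_toFinset,
      Set.mem_sUnion]
    constructor
    · rintro ⟨_, ⟨P, hPS, rfl⟩, hx⟩
      exact ⟨P, hPS, ht P hPS ▸ hx⟩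
    · rintro ⟨P, hPS, hx⟩
      exact ⟨_, ⟨P, hPS, rfl⟩, (ht P hPS).symm ▸ hx⟩
  · rintro ⟨l, rfl⟩
    refine ⟨FlatTerm.eval '' {t | t ∈ l}, (List.finite_toSet l).image _, ?_, ?_⟩
    · rintro _ ⟨t, -, rfl⟩
      exact (isFlatProduct_iff _).2 ⟨t, rfl⟩
    · ext x
      simp [BoolExpr.eval]

theorem mem_closure_isFlatRational_iff (B : Set M) :
    B ∈ BooleanSubalgebra.closure {L | IsFlatRational N L} ↔ ∃ b : BoolExpr N, b.eval = B := by
  constructor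
  · intro h
    induction h using BooleanSubalgebra.closure_bot_sup_induction with
    | mem L hL =>
      obtain ⟨l, rfl⟩ := (isFlatRational_iff L).1 hL
      exact ⟨.flat l, rfl⟩
    | bot => exact ⟨.flat [], by ext x; simp [BoolExpr.eval]⟩
    | sup L₁ _ L₂ _ ih₁ ih₂ =>
      obtain ⟨b₁, rfl⟩ := ih₁
      obtain ⟨b₂, rfl⟩ := ih₂
      exact ⟨.union b₁ b₂, rfl⟩
    | compl L _ ih =>
      obtain ⟨b, rfl⟩ := ih
      exact ⟨.compl b, rfl⟩
  · rintro ⟨b, rfl⟩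
    induction b with
    | flat l => exact BooleanSubalgebra.subset_closure ((isFlatRational_iff _).2 ⟨l, rfl⟩)
    | union b₁ b₂ ih₁ ih₂ => exact BooleanSubalgebra.sup_mem ih₁ ih₂
    | inter b₁ b₂ ih₁ ih₂ => exact BooleanSubalgebra.inf_mem ih₁ ih₂
    | compl b ih => exact BooleanSubalgebra.compl_mem ih

end BooleanCombinations

end FlatRational

/-- The finite Boolean combinations of flat rational subsets of `GL(2,ℚ)` over `GL(2,ℤ)` are
exactly the sets described by Boolean expressions, and there is an algorithm that decides, on
input of (the code of) such an expression, whether the set that it describes is empty. -/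
theorem mainTheorem2 :
    (∀ B : Set (GL (Fin 2) ℚ),
      B ∈ BooleanSubalgebra.closure {L | FlatRational.IsFlatRational FlatRational.GL2Z L} ↔
        ∃ b : FlatRational.BoolExpr FlatRational.GL2Z, b.eval = B) ∧
    ∃ f : ℕ → Bool, Computable f ∧
      ∀ b : FlatRational.BoolExpr FlatRational.GL2Z,
        f (b.code FlatRational.matCode) = true ↔ b.eval = ∅ := by
  exact ⟨fun B => FlatRational.mem_closure_isFlatRational_iff B,
    FlatRational.exists_computable_emptiness⟩
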